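/- Let $\Bbbk$ be a field. A noncommutative Novikov algebra over $\Bbbk$ is a vector space with two bilinear operations $\prec,\succ$ satisfying $$x\succ(y\prec z)=(x\succ y)\prec z,\qquad (x\prec y)\succ z-x\succ(y\succ z)=x\prec(y\succ z)-(x\prec y)\prec z .$$ Monomials of the free associative algebra with derivation $d$ on one generator $x$ are words $u=x^{(n_1)}\cdots x^{(n_m)}$ with $n_i\ge 0$, where $x^{(n)}=d^n(x)$ and $x^{(0)}=x$. The weight of $u$ is $\mathrm{wt}(u)=\sum_{i=1}^m (n_i-1)$. Let $U$ be the set of all words of weight $-1$. For $u\in U$ define the standard bracketing $[u]$, a nonassociative monomial in $x$ with operations $\prec,\succ$ whose number of leaves is the length of $u$, by induction on the length of $u$: 1. If $u=x^{p}\,x^{(k)}\,x^{k-p}$ with $0\le p\le k$ (here $x^p$ and $x^{k-p}$ are words of $p$, respectively $k-p$, letters $x$), then $$[u]=x\prec(x\prec(\cdots\prec(x\prec((\cdots((x\succ x)\succ x)\cdots)\succ x))\cdots))$$ with $p$ signs $\prec$ and $k-p$ signs $\succ$; in particular $[x]=x$. 2. Otherwise $u$ has a proper subword (of consecutive letters)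 of length $>1$ and weight $-1$. Let $v$ be the leftmost such subword, that is, the one whose last letter stands furthest to the left, and the shortest one if several end at that letter. Write $u=u_1vu_2$. Then $[u]$ is obtained from $[u_1xu_2]$ by substituting $[v]$ for the leaf corresponding to the letter $x$ between $u_1$ and $u_2$. Theorem. The elements $[u]$, $u\in U$, evaluated at the free generator $x$, form a linear basis (indexed by $U$; in particular they are pairwise distinct) of the free noncommutative Novikov algebra over $\Bbbk$ on one generator $x$. -/

import Mathlib

/-! ### Differential monomials in one generator `x` -/

/-- The monomials of the free associative algebra with derivation on one generator `x`:
words in the letters `x^(n) = d^n(x)`.  The letter `x^(n)` is recorded by the number `n`, so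
`[n₁, …, n_k]` stands for `x^(n₁) ⋯ x^(n_k)`. -/
abbrev DiffWord : Type := List ℕ

namespace DiffWord

/-- The weight: `wt x = -1`, a derivation adds `1` (so `wt x^(n) = n - 1`), and the weight is
additive on products. -/
def weight (u : DiffWord) : ℤ := (u.map fun n : ℕ => (n : ℤ) - 1).sum

/-- The subword of `u` of length `l` whose last letter is the `e`-th letter of `u`
(letters are counted from `1`, and `l ≤ e ≤ u.length`). -/
def sub (u : DiffWord) (e l : ℕ) : DiffWord := (u.drop (e - l)).take l

/-- The subword `u.sub e l` is a proper subword of `u`, of length `> 1` and of weight `-1`. -/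
def IsReducible (u : DiffWord) (e l : ℕ) : Prop :=
  (2 ≤ l ∧ l ≤ e ∧ e ≤ u.length ∧ l < u.length) ∧ weight (u.sub e l) = -1

instance (u : DiffWord) (e l : ℕ) : Decidable (u.IsReducible e l) := by
  unfold IsReducible; infer_instance

end DiffWord

/-- The set `U` of all differential monomials of weight `-1`. -/
def weightNegOne : Set DiffWord := {u | u.weight = -1}

/-! ### Nonassociative monomials in the operations `≺` and `≻` -/

/-- Nonassociative monomials in one generator `x` with two binary operations, i.e. planar binary
trees with inner vertices labelled by `≺` (`prec`) or `≻` (`succ`). -/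
inductive OpMon : Type
  | x : OpMon
  | prec : OpMon → OpMon → OpMon
  | succ : OpMon → OpMon → OpMon

namespace OpMon

/-- The number of leaves (the degree). -/
def leaves : OpMon → ℕ
  | x => 1
  | prec a b => a.leaves + b.leaves
  | succ a b => a.leaves + b.leaves

/-- `t.subst i s` is `t` with its `i`-th leaf replaced by `s`; leaves are counted from the left,
starting with `0`. -/
def subst : OpMon → ℕ → OpMon → OpMon
  | x, i, s => if i = 0 then s else x
  | prec a b, i, s =>
      if i < a.leaves then prec (a.subst i s) b else prec a (b.subst (i - a.leaves) s)
  | succ a b, i, s =>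
      if i < a.leaves then succ (a.subst i s) b else succ a (b.subst (i - a.leaves) s)

/-- `(⋯((x ≻ x) ≻ x) ≻ ⋯) ≻ x` with `q` operation signs. -/
def rightComb : ℕ → OpMon
  | 0 => x
  | q + 1 => succ (rightComb q) x

/-- `x ≺ (x ≺ (⋯ ≺ (x ≺ t)))` with `p` operation signs. -/
def precIter : ℕ → OpMon → OpMon
  | 0, t => t
  | p + 1, t => prec x (precIter p t)

end OpMon

/-! ### The standard bracketing -/

/-- The standard bracketing `[u]` of a differential monomial `u` of weight `-1`.

* If `u = x^p x^(k) x^(k-p)` (powers `x^p`, `x^(k-p)` of `x` around the letter `x^(k)`), then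
  `[u] = x ≺ (⋯ ≺ (x ≺ ((x ≻ x) ≻ ⋯ ≻ x)))` with `p` signs `≺` and `k - p` signs `≻`.
* Otherwise take the leftmost proper subword `v` of length `> 1` and weight `-1`, i.e. the one
  that ends first, and the shortest one among those that end there. If `u = u₁ v u₂`, then `[u]`
  is obtained from `[u₁ x u₂]` by substituting `[v]` for the leaf at the position of `x`.

Words that admit neither step do not have weight `-1`; they get the dummy value `x`. -/
def stdBracket (u : DiffWord) : OpMon :=
  let k := u.length - 1
  let p := u.idxOf k
  if u = List.replicate p 0 ++ k :: List.replicate (k - p) 0 then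
    OpMon.precIter p (OpMon.rightComb (k - p))
  else if h : ∃ e, e ≤ u.length ∧ ∃ l, l ≤ e ∧ u.IsReducible e l then
    let e := Nat.find h
    let l := Nat.find (Nat.find_spec h).2
    have _hl : u.IsReducible e l := (Nat.find_spec (Nat.find_spec h).2).2
    let i := e - l
    (stdBracket (u.take i ++ 0 :: u.drop e)).subst i (stdBracket (u.sub e l))
  else OpMon.x
termination_by u.length
decreasing_by
  · obtain ⟨⟨h1, h2, h3, -⟩, -⟩ := _hl
    simp only [List.length_append, List.length_take, List.length_cons, List.length_drop]
    omega
  · obtain ⟨⟨-, -, -, h4⟩, -⟩ := _hl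
    simp only [DiffWord.sub, List.length_take, List.length_drop]
    omega

/-! ### Noncommutative Novikov algebras -/

/-- A noncommutative Novikov algebra over `k`: a vector space with two bilinear operations
`≺` (`prec`) and `≻` (`succ`) that satisfy
`x ≻ (y ≺ z) = (x ≻ y) ≺ z` and
`(x ≺ y) ≻ z - x ≻ (y ≻ z) = x ≺ (y ≻ z) - (x ≺ y) ≺ z`. -/
class NCNovikov (k : Type*) (A : Type*) [Field k] [AddCommGroup A] [Module k A] where
  prec : A →ₗ[k] A →ₗ[k] A
  succ : A →ₗ[k] A →ₗ[k] A
  succ_prec : ∀ x y z : A, succ x (prec y z) = prec (succ x y) z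
  prec_succ : ∀ x y z : A,
    succ (prec x y) z - succ x (succ y z) = prec x (succ y z) - prec (prec x y) z

/-- The value of a nonassociative monomial at an element `a` of a noncommutative Novikov algebra. -/
def OpMon.eval (k : Type*) {A : Type*} [Field k] [AddCommGroup A] [Module k A] [NCNovikov k A]
    (a : A) : OpMon → A
  | .x => a
  | .prec s t => NCNovikov.prec (k := k) (s.eval k a) (t.eval k a)
  | .succ s t => NCNovikov.succ (k := k) (s.eval k a) (t.eval k a)

/-! ### The free noncommutative Novikov algebra on one generator -/

section Free

variable (k : Type*) [Field k]

/-- The free algebra with two bilinear operations on one generator: formal linear combinations of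
nonassociative monomials. -/
abbrev FreeTwoOp : Type _ := OpMon →₀ k

namespace FreeTwoOp

/-- The bilinear extension of `≺`. -/
noncomputable def prec : FreeTwoOp k →ₗ[k] FreeTwoOp k →ₗ[k] FreeTwoOp k :=
  Finsupp.linearCombination k fun s : OpMon =>
    Finsupp.linearCombination k fun t : OpMon => Finsupp.single (OpMon.prec s t) (1 : k)

/-- The bilinear extension of `≻`. -/
noncomputable def succ : FreeTwoOp k →ₗ[k] FreeTwoOp k →ₗ[k] FreeTwoOp k :=
  Finsupp.linearCombination k fun s : OpMon =>
    Finsupp.linearCombination k fun t : OpMon => Finsupp.single (OpMon.succ s t) (1 : k)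

/-- A subspace is an ideal if it absorbs both operations on both sides. -/
structure IsIdeal (I : Submodule k (FreeTwoOp k)) : Prop where
  prec_right : ∀ a b, a ∈ I → prec k a b ∈ I
  prec_left : ∀ a b, b ∈ I → prec k a b ∈ I
  succ_right : ∀ a b, a ∈ I → succ k a b ∈ I
  succ_left : ∀ a b, b ∈ I → succ k a b ∈ I

/-- The subspace contains all values of the two defining identities. -/
structure HasRelations (I : Submodule k (FreeTwoOp k)) : Prop where
  succ_prec : ∀ a b c, succ k a (prec k b c) - prec k (succ k a b) c ∈ I
  prec_succ : ∀ a b c,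
    (succ k (prec k a b) c - succ k a (succ k b c)) -
      (prec k a (succ k b c) - prec k (prec k a b) c) ∈ I

/-- The ideal generated by all values of the two defining identities. -/
noncomputable def relIdeal : Submodule k (FreeTwoOp k) :=
  sInf {I | IsIdeal k I ∧ HasRelations k I}

theorem relIdeal_isIdeal : IsIdeal k (relIdeal k) := by
  refine ⟨?_, ?_, ?_, ?_⟩ <;>
    · intro a b h
      simp only [relIdeal, Submodule.mem_sInf, Set.mem_ofPred_eq] at h ⊢
      intro I hI
      first
        | exact hI.1.prec_right a b (h I hI)
        | exact hI.1.prec_left a b (h I hI)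
        | exact hI.1.succ_right a b (h I hI)
        | exact hI.1.succ_left a b (h I hI)

theorem relIdeal_hasRelations : HasRelations k (relIdeal k) := by
  constructor
  · intro a b c
    simp only [relIdeal, Submodule.mem_sInf, Set.mem_ofPred_eq]
    exact fun I hI => hI.2.succ_prec a b c
  · intro a b c
    simp only [relIdeal, Submodule.mem_sInf, Set.mem_ofPred_eq]
    exact fun I hI => hI.2.prec_succ a b c

end FreeTwoOp

/-- The free noncommutative Novikov algebra on one generator. -/
abbrev FreeNCNovikov : Type _ := FreeTwoOp k ⧸ FreeTwoOp.relIdeal k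

namespace FreeNCNovikov

/-- A bilinear operation on the free two-operation algebra that preserves the ideal descends to
the quotient. -/
noncomputable def descend (f : FreeTwoOp k →ₗ[k] FreeTwoOp k →ₗ[k] FreeTwoOp k)
    (h₁ : ∀ a b, a ∈ FreeTwoOp.relIdeal k → f a b ∈ FreeTwoOp.relIdeal k)
    (h₂ : ∀ a b, b ∈ FreeTwoOp.relIdeal k → f a b ∈ FreeTwoOp.relIdeal k) :
    FreeNCNovikov k →ₗ[k] FreeNCNovikov k →ₗ[k] FreeNCNovikov k :=
  (FreeTwoOp.relIdeal k).liftQ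
    { toFun := fun a => (FreeTwoOp.relIdeal k).mapQ (FreeTwoOp.relIdeal k) (f a)
        (fun b hb => h₂ a b hb)
      map_add' := fun a a' => by
        apply Submodule.linearMap_qext
        ext b
        simp
      map_smul' := fun c a => by
        apply Submodule.linearMap_qext
        ext b
        simp }
    (fun a ha => by
      rw [LinearMap.mem_ker]
      apply Submodule.linearMap_qext
      apply LinearMap.ext
      intro b
      simpa using h₁ a b ha)

noncomputable instance : NCNovikov k (FreeNCNovikov k) where
  prec := descend k (FreeTwoOp.prec k) (FreeTwoOp.relIdeal_isIdeal k).prec_right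
    (FreeTwoOp.relIdeal_isIdeal k).prec_left
  succ := descend k (FreeTwoOp.succ k) (FreeTwoOp.relIdeal_isIdeal k).succ_right
    (FreeTwoOp.relIdeal_isIdeal k).succ_left
  succ_prec := by
    intro a b c
    induction a using Submodule.Quotient.induction_on with | _ a
    induction b using Submodule.Quotient.induction_on with | _ b
    induction c using Submodule.Quotient.induction_on with | _ c
    exact (Submodule.Quotient.eq _).2 ((FreeTwoOp.relIdeal_hasRelations k).succ_prec a b c)
  prec_succ := by
    intro a b c
    induction a using Submodule.Quotient.induction_on with | _ a
    induction b using Submodule.Quotient.induction_on with | _ b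
    induction c using Submodule.Quotient.induction_on with | _ c
    exact (Submodule.Quotient.eq _).2 ((FreeTwoOp.relIdeal_hasRelations k).prec_succ a b c)

/-- The free generator. -/
noncomputable def gen : FreeNCNovikov k :=
  (FreeTwoOp.relIdeal k).mkQ (Finsupp.single OpMon.x 1)

end FreeNCNovikov

end Free

/-! In an associative algebra with derivation, $x\succ y=d(x)y$ and $x\prec y=x\,d(y)$ satisfy both
identities, so monomials have values in the free differential algebra, supported on words of weight
$-1$. The theorem follows from two independent facts.

(1) Nothing is lost by passing to differential polynomials: in any noncommutative Novikov algebra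
$A$ with $a\in A$, every word of weight $-1$ has a value at $a$ (`wordVal`), and this assignment
respects $\prec$ and $\succ$ (`prec_wordVal`, `succ_wordVal`). Words of weight $0$ have no value in
$A$, but act on $A$ by left and right multiplication; these operators (`wordOp`) lie in the algebra
generated by the operators of the derivatives $a'$. They are defined by solving the Leibniz rule for
one term, and a word $w_1xw_2$ with $w_1,w_2$ of weight $0$ takes the value $w_1\cdot a\cdot w_2$.
The work is to show, by induction on the length, that the choice of $x$ does not matter
(`valSplit_of_lt`) and that the full Leibniz rule holds (`derVal_of_lt`). The second Novikov
identity enters as the statement that $b''$ may act to either side (`sum_transfer`). Hence a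
monomial's value in $A$ depends only on its differential polynomial (`toNCNovikov_eval`).

(2) The values of the $[u]$ in the free differential algebra are unitriangular: for a lexicographic
order on words of equal length, $[u]$ has leading word $u$ with coefficient $1$ (`eval_stdBracket`).
A word is read by a stack machine in which $x^{(m)}$ is an operation with $m$ operands, and the rank
of a letter depends on the number of operands available. The leftmost reducible subword is a corolla
$x^px^{(p+q)}x^q$, reading it has the effect of reading $x$ (`run_corolla`), and substituting a
corolla for $x$ preserves leading words (`insert_mem_smallerWords`).

By (2) the $[u]$ are independent and span all differential polynomials of weight $-1$; by (1) the
spanning carries over to the free algebra. -/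

/-! ### Weights of words and their prefixes, and the Leibniz rule on words -/

namespace DiffWord

@[simp] theorem weight_nil : weight [] = 0 := rfl

@[simp] theorem weight_cons (n : ℕ) (u : DiffWord) :
    weight (n :: u) = (n : ℤ) - 1 + weight u := by simp [weight]

@[simp] theorem weight_append (u v : DiffWord) : weight (u ++ v) = weight u + weight v := by
  simp [weight]

theorem weight_take_add_weight_drop (i : ℕ) (u : DiffWord) :
    weight (u.take i) + weight (u.drop i) = weight u := by
  rw [← weight_append, List.take_append_drop]

/-- The word `u` with its `j`-th letter (counted from `0`) differentiated. -/
def raise (j : ℕ) (u : DiffWord) : DiffWord := u.modify j (· + 1)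

/-- The word `u` with the order of the derivative at its `j`-th letter decreased by one. -/
def lower (j : ℕ) (u : DiffWord) : DiffWord := u.modify j (· - 1)

@[simp] theorem length_raise (j : ℕ) (u : DiffWord) : (raise j u).length = u.length := by
  simp [raise]

@[simp] theorem length_lower (j : ℕ) (u : DiffWord) : (lower j u).length = u.length := by
  simp [lower]

@[simp] theorem raise_zero_cons (n : ℕ) (u : DiffWord) : raise 0 (n :: u) = (n + 1) :: u := by
  simp [raise]

@[simp] theorem raise_succ_cons (j n : ℕ) (u : DiffWord) :
    raise (j + 1) (n :: u) = n :: raise j u := by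
  simp [raise]

theorem lower_raise (j : ℕ) (u : DiffWord) : lower j (raise j u) = u := by
  induction u generalizing j with
  | nil => simp [lower, raise]
  | cons n u ih => cases j <;> simp_all [lower, raise]

theorem raise_lower {j : ℕ} {u : DiffWord} (h : 1 ≤ u.getD j 0) : raise j (lower j u) = u := by
  induction u generalizing j with
  | nil => simp at h
  | cons n u ih => cases j <;> simp_all [lower, raise]

theorem getD_raise_of_ne {i j : ℕ} (h : i ≠ j) (u : DiffWord) :
    (raise j u).getD i 0 = u.getD i 0 := by
  induction u generalizing i j with
  | nil => simp [raise]
  | cons n u ih => cases i <;> cases j <;> simp_all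

theorem getD_raise_self {j : ℕ} {u : DiffWord} (h : j < u.length) :
    (raise j u).getD j 0 = u.getD j 0 + 1 := by
  induction u generalizing j with
  | nil => simp at h
  | cons n u ih => cases j <;> simp_all

theorem getD_lower_self (j : ℕ) (u : DiffWord) : (lower j u).getD j 0 = u.getD j 0 - 1 := by
  induction u generalizing j with
  | nil => simp [lower]
  | cons n u ih => cases j <;> simp_all [lower]

theorem raise_append_of_lt {j : ℕ} {u : DiffWord} (h : j < u.length) (v : DiffWord) :
    raise j (u ++ v) = raise j u ++ v := by
  induction u generalizing j with
  | nil => simp at h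
  | cons n u ih => cases j <;> simp_all

theorem raise_append_add (j : ℕ) (u v : DiffWord) :
    raise (u.length + j) (u ++ v) = u ++ raise j v := by
  induction u with
  | nil => simp
  | cons n u ih => simpa [Nat.add_right_comm] using ih

theorem weight_raise {j : ℕ} {u : DiffWord} (h : j < u.length) :
    weight (raise j u) = weight u + 1 := by
  induction u generalizing j with
  | nil => simp at h
  | cons n u ih =>
    cases j with
    | zero => simp; ring
    | succ j => simp [ih (by simpa using h)]; ring

theorem weight_take_raise {j : ℕ} {u : DiffWord} (h : j < u.length) (i : ℕ) :
    weight ((raise j u).take i) = weight (u.take i) + if j < i then 1 else 0 := by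
  induction u generalizing i j with
  | nil => simp at h
  | cons n u ih =>
    cases i with
    | zero => simp
    | succ i =>
      cases j with
      | zero => simp; ring
      | succ j => simp [ih (by simpa using h)]; ring

theorem weight_take_lower {j : ℕ} {u : DiffWord} (h : 1 ≤ u.getD j 0) (i : ℕ) :
    weight ((lower j u).take i) = weight (u.take i) - if j < i then 1 else 0 := by
  have hj : j < u.length := by
    by_contra hj
    rw [List.getD_eq_default _ _ (not_lt.1 hj)] at h
    omega
  have := weight_take_raise (u := lower j u) (j := j) (by simpa using hj) i
  rw [raise_lower h] at this
  omega

theorem weight_take_succ {i : ℕ} {u : DiffWord} (h : i < u.length) :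
    weight (u.take (i + 1)) = weight (u.take i) + (u.getD i 0 : ℤ) - 1 := by
  induction u generalizing i with
  | nil => simp at h
  | cons n u ih =>
    cases i with
    | zero => simp
    | succ i => simp [ih (by simpa using h)]; ring

theorem eq_take_append_cons_drop {i : ℕ} {u : DiffWord} (h : i < u.length) :
    u = u.take i ++ u.getD i 0 :: u.drop (i + 1) := by
  induction u generalizing i with
  | nil => simp at h
  | cons n u ih =>
    cases i with
    | zero => simp
    | succ i => simpa using ih (by simpa using h)

/-- The Leibniz rule. -/
theorem sum_raise_append {M : Type*} [AddCommMonoid M] (F : DiffWord → M) (u v : DiffWord) :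
    ∑ j ∈ Finset.range (u ++ v).length, F (raise j (u ++ v)) =
      ∑ j ∈ Finset.range u.length, F (raise j u ++ v) +
        ∑ j ∈ Finset.range v.length, F (u ++ raise j v) := by
  rw [List.length_append, Finset.sum_range_add]
  congr 1
  · exact Finset.sum_congr rfl fun j hj => by
      rw [raise_append_of_lt (Finset.mem_range.1 hj)]
  · exact Finset.sum_congr rfl fun j _ => by rw [raise_append_add]

end DiffWord

/-! ### Multiplication operators by derivatives -/

namespace NCNovikov

section Operators

variable (k : Type*) {A : Type*} [Field k] [AddCommGroup A] [Module k A] [NCNovikov k A]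

/-- Pairs of a left operator and a right operator on `A`. -/
abbrev OpPair (k A : Type*) [Field k] [AddCommGroup A] [Module k A] : Type _ :=
  Module.End k A × (Module.End k A)ᵐᵒᵖ

/-- The pair of operators `a ≻ ·` and `· ≺ a`, which is left and right multiplication by the
derivative of `a` in a differential algebra. -/
noncomputable def der : A →ₗ[k] OpPair k A :=
  (succ (k := k) (A := A)).prod
    ((MulOpposite.opLinearEquiv k).toLinearMap ∘ₗ (prec (k := k) (A := A)).flip)

@[simp] theorem der_fst_apply (a b : A) : (der k a).1 b = succ (k := k) a b := rfl

@[simp] theorem der_snd_apply (a b : A) : (der k a).2.unop b = prec (k := k) b a := rfl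

/-- The algebra generated by the derivatives of the elements of `A`. -/
noncomputable def derAlg (k A : Type*) [Field k] [AddCommGroup A] [Module k A]
    [NCNovikov k A] : Subalgebra k (OpPair k A) :=
  Algebra.adjoin k (Set.range (der k (A := A)))

theorem der_mem (a : A) : der k a ∈ derAlg k A := Algebra.subset_adjoin ⟨a, rfl⟩

variable {k}

/-- On generators this is the first identity, $a\succ(c\prec b)=(a\succ c)\prec b$; commutation is
inherited by the generated algebra. -/
theorem left_right_comm {e f : OpPair k A} (he : e ∈ derAlg k A) (hf : f ∈ derAlg k A) (c : A) :
    e.1 (f.2.unop c) = f.2.unop (e.1 c) := by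
  induction he using Algebra.adjoin_induction generalizing c with
  | mem e he =>
    obtain ⟨a, rfl⟩ := he
    induction hf using Algebra.adjoin_induction generalizing c with
    | mem f hf => obtain ⟨b, rfl⟩ := hf; simpa using succ_prec a c b
    | algebraMap r => simp [Algebra.algebraMap_eq_smul_one]
    | add f g _ _ ihf ihg => simp_all
    | mul f g _ _ ihf ihg => simp_all
  | algebraMap r => simp [Algebra.algebraMap_eq_smul_one]
  | add e e' _ _ ih ih' => simp_all
  | mul e e' _ _ ih ih' => simp_all

/-- The derivative of `a' b c'`. -/
theorem der_succ_prec (a b c : A) :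
    der k ((der k a).1 ((der k c).2.unop b)) =
      der k ((der k a).1 b) * der k c + der k a * der k ((der k c).2.unop b) -
        der k a * der k b * der k c := by
  refine Prod.ext (LinearMap.ext fun z => ?_)
    (MulOpposite.unop_injective (LinearMap.ext fun z => ?_))
  · have h₁ := prec_succ (k := k) (succ (k := k) a b) c z
    have h₂ := congrArg (succ (k := k) a) (prec_succ (k := k) b c z)
    simp only [map_sub, succ_prec] at h₂
    simp only [der_fst_apply, der_snd_apply, Prod.fst_sub, Prod.fst_add, Prod.fst_mul,
      LinearMap.sub_apply, LinearMap.add_apply, Module.End.mul_apply, succ_prec]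
    linear_combination (norm := abel) h₁ - h₂
  · have h₁ := prec_succ (k := k) z a (prec (k := k) b c)
    have h₂ := congrArg (fun t => prec (k := k) t c) (prec_succ (k := k) z a b)
    simp only [map_sub, succ_prec, LinearMap.sub_apply] at h₁ h₂
    simp only [der_fst_apply, der_snd_apply, Prod.snd_sub, Prod.snd_add, Prod.snd_mul,
      MulOpposite.unop_sub, MulOpposite.unop_add, MulOpposite.unop_mul,
      LinearMap.sub_apply, LinearMap.add_apply, Module.End.mul_apply, succ_prec]
    linear_combination (norm := abel) h₂ - h₁

/-- This is $(ebf)'=(eb)'f+e(bf)'-eb'f$. It is `der_succ_prec` on generators and passes to products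
by applying the formula repeatedly, for instance with $e'b$ in place of $b$. -/
theorem der_left_right {e f : OpPair k A} (he : e ∈ derAlg k A) (hf : f ∈ derAlg k A) (b : A) :
    der k (e.1 (f.2.unop b)) =
      der k (e.1 b) * f + e * der k (f.2.unop b) - e * der k b * f := by
  induction he using Algebra.adjoin_induction generalizing b with
  | mem e he =>
    obtain ⟨a, rfl⟩ := he
    induction hf using Algebra.adjoin_induction generalizing b with
    | mem f hf => obtain ⟨c, rfl⟩ := hf; exact der_succ_prec a b c
    | algebraMap r => simp [Algebra.algebraMap_eq_smul_one]
    | add f g _ _ ihf ihg =>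
      simp only [Prod.snd_add, MulOpposite.unop_add, LinearMap.add_apply, map_add, ihf, ihg]
      noncomm_ring
    | mul f g hf hg ihf ihg =>
      simp only [Prod.snd_mul, MulOpposite.unop_mul, Module.End.mul_apply, ihf, ihg]
      noncomm_ring
  | algebraMap r => simp [Algebra.algebraMap_eq_smul_one]
  | add e e' _ _ ih ih' =>
    simp only [Prod.fst_add, LinearMap.add_apply, map_add, ih, ih']
    noncomm_ring
  | mul e e' he he' ih ih' =>
    have h := ih (e'.1 b)
    rw [← left_right_comm he' hf] at h
    simp only [Prod.fst_mul, Module.End.mul_apply, h, ih']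
    noncomm_ring

end Operators

end NCNovikov

/-! ### Splitting words of weight 0 and marking a letter in words of weight -1 -/

namespace DiffWord

/-- A word has a proper nonempty prefix of weight `0`. -/
def Splits (w : DiffWord) : Prop := ∃ i, 0 < i ∧ i < w.length ∧ weight (w.take i) = 0

/-- The length of the shortest proper nonempty prefix of weight `0`, if there is one. -/
noncomputable def firstSplit (w : DiffWord) : ℕ :=
  open Classical in
  if h : ∃ i, 0 < i ∧ i < w.length ∧ weight (w.take i) = 0 then Nat.find h else 0

theorem Splits.firstSplit_spec {w : DiffWord} (h : w.Splits) :
    0 < w.firstSplit ∧ w.firstSplit < w.length ∧ weight (w.take w.firstSplit) = 0 := by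
  classical
  have hw : w.firstSplit = Nat.find h := dif_pos h
  rw [hw]
  exact Nat.find_spec h

theorem firstSplit_eq {w : DiffWord} {i : ℕ} (h₁ : 0 < i) (h₂ : i < w.length)
    (h₃ : weight (w.take i) = 0) (h₄ : ∀ j, 0 < j → j < i → weight (w.take j) ≠ 0) :
    w.firstSplit = i := by
  classical
  have h : ∃ i, 0 < i ∧ i < w.length ∧ weight (w.take i) = 0 := ⟨i, h₁, h₂, h₃⟩
  rw [firstSplit, dif_pos h]
  convert (Nat.find_eq_iff h).2 ⟨⟨h₁, h₂, h₃⟩, fun j hj hj' => h₄ j hj'.1 hj hj'.2.2⟩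

/-- The position of the letter with which the weights of the prefixes become nonnegative. -/
noncomputable def center (w : DiffWord) : ℕ :=
  open Classical in
  if h : ∃ i, 0 ≤ weight (w.take (i + 1)) then Nat.find h else 0

/-- The position of the letter with which the weights of the prefixes become negative. -/
noncomputable def firstNeg (w : DiffWord) : ℕ :=
  open Classical in
  if h : ∃ i, weight (w.take (i + 1)) < 0 then Nat.find h else 0

/-- The auxiliary quantity that decreases along the recursion defining the operators of the words
of weight `0` of a fixed length. -/
noncomputable def centerOrder (w : DiffWord) : ℕ :=
  open Classical in
  if w.Splits then 0 else w.getD w.center 0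

theorem center_eq {w : DiffWord} {c : ℕ} (h : 0 ≤ weight (w.take (c + 1)))
    (h' : ∀ i < c, weight (w.take (i + 1)) < 0) : w.center = c := by
  classical
  have hex : ∃ i, 0 ≤ weight (w.take (i + 1)) := ⟨c, h⟩
  rw [center, dif_pos hex]
  convert (Nat.find_eq_iff hex).2 ⟨h, fun i hi => not_le.2 (h' i hi)⟩

theorem center_spec {w : DiffWord} (hw : weight w = 0) :
    0 ≤ weight (w.take (w.center + 1)) ∧ ∀ i < w.center, weight (w.take (i + 1)) < 0 := by
  classical
  have hex : ∃ i, 0 ≤ weight (w.take (i + 1)) :=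
    ⟨w.length, by rw [List.take_of_length_le (by omega), hw]⟩
  rw [center, dif_pos hex]
  exact ⟨Nat.find_spec hex, fun i hi => not_le.1 (Nat.find_min hex hi)⟩

theorem center_lt_length {w : DiffWord} (hw : weight w = 0) (h : w ≠ []) :
    w.center < w.length := by
  by_contra hc
  have hl : 0 < w.length := List.length_pos_iff.2 h
  have := (center_spec hw).2 (w.length - 1) (by omega)
  rw [List.take_of_length_le (by omega)] at this
  omega

/-- A word of weight `-1` is `w₁ x w₂` with words `w₁`, `w₂` of weight `0`. -/
theorem firstNeg_spec {b : DiffWord} (hb : weight b = -1) :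
    b.firstNeg < b.length ∧ weight (b.take b.firstNeg) = 0 ∧ b.getD b.firstNeg 0 = 0 ∧
      weight (b.drop (b.firstNeg + 1)) = 0 ∧
      ∀ i < b.firstNeg, 0 ≤ weight (b.take (i + 1)) := by
  classical
  have hex : ∃ i, weight (b.take (i + 1)) < 0 :=
    ⟨b.length, by rw [List.take_of_length_le (by omega), hb]; omega⟩
  have hj : b.firstNeg = Nat.find hex := by rw [firstNeg, dif_pos hex]
  have h₁ : weight (b.take (b.firstNeg + 1)) < 0 := hj ▸ Nat.find_spec hex
  have h₂ : ∀ i < b.firstNeg, 0 ≤ weight (b.take (i + 1)) := fun i hi =>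
    not_lt.1 (Nat.find_min hex (hj ▸ hi))
  have h₃ : 0 ≤ weight (b.take b.firstNeg) := by
    rcases Nat.eq_zero_or_pos b.firstNeg with h | h
    · simp [h]
    · have := h₂ (b.firstNeg - 1) (by omega)
      rwa [Nat.sub_add_cancel h] at this
  have h₄ : b.firstNeg < b.length := by
    by_contra hc
    rw [List.take_of_length_le (by omega)] at h₁ h₃
    omega
  have h₅ := weight_take_succ h₄
  have h₆ := weight_take_add_weight_drop (b.firstNeg + 1) b
  refine ⟨h₄, by omega, by omega, by omega, h₂⟩

theorem eq_firstNeg_split {b : DiffWord} (hb : weight b = -1) :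
    b = b.take b.firstNeg ++ 0 :: b.drop (b.firstNeg + 1) := by
  have h := firstNeg_spec hb
  have := eq_take_append_cons_drop h.1
  rwa [h.2.2.1] at this

/-- The letter at the center of an unsplittable word `w` of weight `0`, and its position. -/
theorem center_spec_of_not_splits {w : DiffWord} (hw : weight w = 0) (h : w ≠ [])
    (hs : ¬ w.Splits) :
    1 ≤ w.getD w.center 0 ∧ (∀ i, 0 < i → i ≤ w.center → weight (w.take i) < 0) ∧
      ∀ i, w.center < i → i < w.length → 0 < weight (w.take i) := by
  have hc := center_spec hw
  have hl := center_lt_length hw h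
  have h₁ : ∀ i, 0 < i → i ≤ w.center → weight (w.take i) < 0 := fun i hi hic => by
    have := hc.2 (i - 1) (by omega)
    rwa [Nat.sub_add_cancel hi] at this
  have h₂ : ∀ i, 0 < i → i < w.length → weight (w.take i) ≠ 0 := fun i hi hil hwi =>
    hs ⟨i, hi, hil, hwi⟩
  refine ⟨?_, h₁, ?_⟩
  · have := weight_take_succ hl
    rcases Nat.eq_zero_or_pos w.center with h0 | h0
    · have h00 : weight (w.take 0) = 0 := by simp
      rw [h0] at this hc ⊢
      have := hc.1
      omega
    · have := h₁ w.center h0 le_rfl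
      omega
  · intro i hi
    induction i, hi using Nat.le_induction with
    | base =>
      intro h3
      have := h₂ _ (by omega) h3
      have := hc.1
      simp only [Nat.succ_eq_add_one] at *
      omega
    | succ i hi ih =>
      intro h3
      have := ih (by omega)
      have := h₂ (i + 1) (by omega) h3
      have := weight_take_succ (u := w) (i := i) (by omega)
      omega

/-- Prefix weights of $w$ are negative up to the center and positive after it. Moving one derivative
from the center elsewhere shifts each by at most one, so a sign can only be lost by reaching $0$,
which is a split. Without a split the center stays in place and its order drops. -/
theorem centerOrder_raise_lower {w : DiffWord} (hw : weight w = 0) (h : w ≠ [])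
    (hs : ¬ w.Splits) {j : ℕ} (hj : j < w.length) (hjc : j ≠ w.center) :
    centerOrder (raise j (lower w.center w)) < centerOrder w := by
  classical
  have hl := center_lt_length hw h
  obtain ⟨h₁, h₂, h₃⟩ := center_spec_of_not_splits hw h hs
  set c := w.center with hcdef
  have htake (i : ℕ) := weight_take_raise (u := lower c w) (j := j) (by simpa using hj) i
  simp only [weight_take_lower h₁] at htake
  rw [centerOrder, centerOrder, if_neg hs]
  split_ifs with hs'
  · exact h₁
  · have hne : ∀ i, 0 < i → i < w.length → weight ((raise j (lower c w)).take i) ≠ 0 :=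
      fun i hi hil hwi => hs' ⟨i, hi, by simpa using hil, hwi⟩
    have hc : center (raise j (lower c w)) = c := by
      apply center_eq
      · rw [htake]
        rcases Nat.lt_or_ge (c + 1) w.length with h4 | h4
        · have := h₃ (c + 1) (by omega) h4
          split_ifs <;> omega
        · rw [List.take_of_length_le h4, hw, if_pos (by omega), if_pos (by omega)]
          omega
      · intro i hi
        have := h₂ (i + 1) (by omega) (by omega)
        have := hne (i + 1) (by omega) (by omega)
        have := htake (i + 1)
        rw [if_neg (by omega : ¬ c < i + 1)] at this
        split_ifs at this <;> omega
    rw [hc, getD_raise_of_ne (Ne.symm hjc), getD_lower_self, ← hcdef]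
    omega

end DiffWord

/-! ### Operators of words of weight 0 and values of words of weight -1 -/

namespace NCNovikov

open DiffWord

variable {k : Type*} {A : Type*} [Field k] [AddCommGroup A] [Module k A] [NCNovikov k A]

variable (k) in
/-- The operators on `A` of multiplication by the value at `a` of a word of weight `0`. -/
noncomputable def wordOp (a : A) (w : DiffWord) : OpPair k A :=
  open Classical in
  if w = [] then 1
  else if w.Splits then
    -- The length and order conditions here and below serve termination only and hold for all words
    -- of weight $0$; `j ≠ w.center` omits the term for which the Leibniz rule is solved.
    if _h : (w.take w.firstSplit).length < w.length ∧
        (w.drop w.firstSplit).length < w.length then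
      wordOp a (w.take w.firstSplit) * wordOp a (w.drop w.firstSplit)
    else 0
  else
    -- `w` is the term of the derivative of `b` that differentiates the letter at the center; its
    -- operator is the derivative of the value of `b` minus all other terms.
    let b := lower w.center w
    (if _h : (b.take b.firstNeg).length < w.length ∧
        (b.drop (b.firstNeg + 1)).length < w.length then
      der k ((wordOp a (b.take b.firstNeg)).1 ((wordOp a (b.drop (b.firstNeg + 1))).2.unop a))
    else 0) -
    ∑ j ∈ Finset.range w.length,
      if _h : j ≠ w.center ∧ (raise j b).length = w.length ∧
          (raise j b).centerOrder < w.centerOrder then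
        wordOp a (raise j b)
      else 0
termination_by (w.length, w.centerOrder)
decreasing_by
  · exact Prod.Lex.left _ _ _h.1
  · exact Prod.Lex.left _ _ _h.2
  · exact Prod.Lex.left _ _ _h.1
  · exact Prod.Lex.left _ _ _h.2
  · rw [_h.2.1]; exact Prod.Lex.right _ _h.2.2

variable (k) in
/-- The value at `a` of a word of weight `-1`. -/
noncomputable def wordVal (a : A) (b : DiffWord) : A :=
  (wordOp k a (b.take b.firstNeg)).1 ((wordOp k a (b.drop (b.firstNeg + 1))).2.unop a)

variable (a : A)

@[simp] theorem wordOp_nil : wordOp k a [] = 1 := by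
  rw [wordOp, if_pos rfl]

theorem wordOp_of_not_splits {w : DiffWord} (hw : weight w = 0) (h : w ≠ []) (hs : ¬ w.Splits) :
    wordOp k a w = der k (wordVal k a (lower w.center w)) -
      ∑ j ∈ (Finset.range w.length).erase w.center, wordOp k a (raise j (lower w.center w)) := by
  have hl := center_lt_length hw h
  obtain ⟨h₁, -, -⟩ := center_spec_of_not_splits hw h hs
  have hb : weight (lower w.center w) = -1 := by
    have := weight_take_lower h₁ w.length
    rw [List.take_of_length_le (by simp), List.take_of_length_le le_rfl, hw, if_pos hl] at this
    omega
  have hf := (firstNeg_spec hb).1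
  rw [length_lower] at hf
  rw [wordOp, if_neg h, if_neg hs]
  simp only
  rw [dif_pos (by simp; omega), wordVal]
  congr 1
  refine (Finset.sum_erase (a := w.center) _ (dif_neg (by simp))).symm.trans
    (Finset.sum_congr rfl fun j hj => ?_)
  rw [Finset.mem_erase, Finset.mem_range] at hj
  rw [dif_pos ⟨hj.1, by simp, centerOrder_raise_lower hw h hs hj.2 hj.1⟩]

theorem wordOp_of_splits {w : DiffWord} (hs : w.Splits) :
    wordOp k a w = wordOp k a (w.take w.firstSplit) * wordOp k a (w.drop w.firstSplit) := by
  have h := hs.firstSplit_spec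
  have hw : w ≠ [] := by rintro rfl; simp at h
  conv_lhs => rw [wordOp, if_neg hw, if_pos hs, dif_pos (by simp; omega)]

/-- The first split of $uv$ is that of $u$, or the end of $u$ if $u$ does not split; associativity
and induction on the length of $u$ do the rest. -/
theorem wordOp_append {u v : DiffWord} (hu : weight u = 0) (hv : weight v = 0) :
    wordOp k a (u ++ v) = wordOp k a u * wordOp k a v := by
  induction hn : u.length using Nat.strong_induction_on generalizing u with
  | _ n ih =>
  rcases eq_or_ne u [] with rfl | hu0
  · simp
  rcases eq_or_ne v [] with rfl | hv0
  · simp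
  have hul : 0 < u.length := List.length_pos_iff.2 hu0
  have hvl : 0 < v.length := List.length_pos_iff.2 hv0
  have hs : (u ++ v).Splits := ⟨u.length, hul, by simp; omega, by simp [hu]⟩
  rw [wordOp_of_splits a hs]
  by_cases hsu : u.Splits
  · have hspec := hsu.firstSplit_spec
    have hfirst : (u ++ v).firstSplit = u.firstSplit := by
      classical
      refine firstSplit_eq hspec.1 (by simp; omega) ?_ fun j hj hj' hj'' => ?_
      · rw [List.take_append_of_le_length hspec.2.1.le]
        exact hspec.2.2
      · rw [List.take_append_of_le_length (by omega)] at hj''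
        have h : u.firstSplit = Nat.find hsu := dif_pos hsu
        exact Nat.find_min hsu (h ▸ hj') ⟨hj, by omega, hj''⟩
    have hw := weight_take_add_weight_drop u.firstSplit u
    rw [hfirst, List.take_append_of_le_length hspec.2.1.le,
      List.drop_append_of_le_length hspec.2.1.le,
      ih _ (by rw [← hn, List.length_drop]; omega) (by omega) rfl, ← mul_assoc,
      ← wordOp_of_splits a hsu]
  · have hfirst : (u ++ v).firstSplit = u.length := by
      refine firstSplit_eq hul (by simp; omega) (by simp [hu]) fun j hj hj' hj'' => ?_
      rw [List.take_append_of_le_length (by omega)] at hj''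
      exact hsu ⟨j, hj, hj', hj''⟩
    rw [hfirst]
    simp

theorem wordOp_mem {w : DiffWord} (hw : weight w = 0) : wordOp k a w ∈ derAlg k A := by
  induction hn : w.length using Nat.strong_induction_on generalizing w with
  | _ n ih =>
  induction hm : w.centerOrder using Nat.strong_induction_on generalizing w with
  | _ m ih' =>
  rcases eq_or_ne w [] with rfl | hw0
  · simp
  by_cases hs : w.Splits
  · have hspec := hs.firstSplit_spec
    have := weight_take_add_weight_drop w.firstSplit w
    rw [wordOp_of_splits a hs]
    exact mul_mem (ih _ (by rw [← hn, List.length_take]; omega) hspec.2.2 rfl)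
      (ih _ (by rw [← hn, List.length_drop]; omega) (by omega) rfl)
  · rw [wordOp_of_not_splits a hw hw0 hs]
    refine sub_mem (der_mem k _) (sum_mem fun j hj => ?_)
    rw [Finset.mem_erase, Finset.mem_range] at hj
    refine ih' _ (hm ▸ centerOrder_raise_lower hw hw0 hs hj.2 hj.1) ?_ (by simpa using hn) rfl
    have h₁ := (center_spec_of_not_splits hw hw0 hs).1
    rw [weight_raise (by simpa using hj.2)]
    have h₂ := weight_take_lower h₁ w.length
    rw [List.take_of_length_le (by simp), List.take_of_length_le le_rfl, hw,
      if_pos (center_lt_length hw hw0)] at h₂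
    omega

end NCNovikov

/-! ### Independence of the marked letter and the Leibniz rule, by induction on the length -/

namespace NCNovikov

open DiffWord

variable {k : Type*} {A : Type*} [Field k] [AddCommGroup A] [Module k A] [NCNovikov k A] (a : A)

variable (k) in
/-- For words of length `m`, all ways to mark a letter `x` give the same value. -/
def ValSplit (m : ℕ) : Prop :=
  ∀ u v : DiffWord, weight u = 0 → weight v = 0 → u.length + v.length + 1 = m →
    wordVal k a (u ++ 0 :: v) = (wordOp k a u).1 ((wordOp k a v).2.unop a)

variable (k) in
/-- For words of length `m`, the operators of the derivative are given by the Leibniz rule. -/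
def DerVal (m : ℕ) : Prop :=
  ∀ b : DiffWord, weight b = -1 → b.length = m →
    ∑ j ∈ Finset.range b.length, wordOp k a (raise j b) = der k (wordVal k a b)

variable (k) in
/-- A word `z` of weight `1` between `u` and `v` may act on either side. -/
def Transfers (m : ℕ) (z : DiffWord) : Prop :=
  ∀ u v : DiffWord, weight u = -1 → weight v = -1 → u.length + z.length + v.length ≤ m →
    (wordOp k a (z ++ v)).2.unop (wordVal k a u) = (wordOp k a (u ++ z)).1 (wordVal k a v)

variable {a}

/-- The letter marked in $u$ also marks $uv$; only the right factor grows, and right operators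
commute with left ones. -/
theorem ValSplit.append {u v : DiffWord} (h : ValSplit k a (u.length + v.length))
    (hu : weight u = -1) (hv : weight v = 0) :
    (wordOp k a v).2.unop (wordVal k a u) = wordVal k a (u ++ v) := by
  have hf := firstNeg_spec hu
  have he := eq_firstNeg_split hu
  have hl := congrArg List.length he
  simp only [List.length_append, List.length_cons] at hl
  conv_rhs => rw [he, List.append_assoc, List.cons_append]
  rw [h _ _ hf.2.1 (by simp [hf.2.2.2.1, hv]) (by rw [List.length_append]; omega),
    wordOp_append a hf.2.2.2.1 hv, wordVal,
    ← left_right_comm (wordOp_mem a hf.2.1) (wordOp_mem a hv)]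
  simp

theorem ValSplit.prepend {u v : DiffWord} (h : ValSplit k a (u.length + v.length))
    (hu : weight u = 0) (hv : weight v = -1) :
    (wordOp k a u).1 (wordVal k a v) = wordVal k a (u ++ v) := by
  have hf := firstNeg_spec hv
  have he := eq_firstNeg_split hv
  have hl := congrArg List.length he
  simp only [List.length_append, List.length_cons] at hl
  conv_rhs => rw [he, ← List.append_assoc]
  rw [h _ _ (by simp [hf.2.1, hu]) hf.2.2.2.1 (by rw [List.length_append]; omega),
    wordOp_append a hu hf.2.1, wordVal]
  simp

theorem Transfers.append {m : ℕ} {z w : DiffWord} (hval : ∀ n < m, ValSplit k a n)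
    (h : Transfers k a m z) (hz : weight z = 1) (hw : weight w = 0) :
    Transfers k a m (z ++ w) := by
  intro u v hu hv hm
  have hu0 : 0 < u.length := List.length_pos_iff.2 (by rintro rfl; simp at hu)
  rw [List.length_append] at hm
  rw [← List.append_assoc u, wordOp_append a (by simp [hu, hz]) hw, List.append_assoc,
    h u (w ++ v) hu (by simp [hw, hv]) (by rw [List.length_append]; omega),
    ← (hval _ (by omega)).prepend hw hv]
  simp

theorem Transfers.prepend {m : ℕ} {z w : DiffWord} (hval : ∀ n < m, ValSplit k a n)
    (h : Transfers k a m z) (hz : weight z = 1) (hw : weight w = 0) :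
    Transfers k a m (w ++ z) := by
  intro u v hu hv hm
  have hv0 : 0 < v.length := List.length_pos_iff.2 (by rintro rfl; simp at hv)
  rw [List.length_append] at hm
  rw [List.append_assoc w, wordOp_append a hw (by simp [hv, hz]), ← List.append_assoc,
    ← h (u ++ w) v (by simp [hw, hu]) hv (by rw [List.length_append]; omega),
    ← (hval _ (by omega)).append hu hw]
  simp

/-- This is $(ub')'=u'b'+ub''$, with each derivative expanded over words. -/
theorem der_prec_wordVal {u b : DiffWord} (hu : weight u = -1) (hb : weight b = -1)
    (hval : ValSplit k a (u.length + b.length)) (hder : DerVal k a (u.length + b.length))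
    (hderu : DerVal k a u.length) (hderb : DerVal k a b.length) :
    der k (prec (k := k) (wordVal k a u) (wordVal k a b)) =
      der k (wordVal k a u) * der k (wordVal k a b) +
        ∑ i ∈ Finset.range b.length, ∑ j ∈ Finset.range b.length,
          wordOp k a (u ++ raise j (raise i b)) := by
  have hb' {i : ℕ} (hi : i ∈ Finset.range b.length) : weight (raise i b) = 0 := by
    rw [weight_raise (Finset.mem_range.1 hi), hb]; rfl
  have hu' {i : ℕ} (hi : i ∈ Finset.range u.length) : weight (raise i u) = 0 := by
    rw [weight_raise (Finset.mem_range.1 hi), hu]; rfl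
  have h₁ : prec (k := k) (wordVal k a u) (wordVal k a b) =
      ∑ i ∈ Finset.range b.length, wordVal k a (u ++ raise i b) := by
    rw [← der_snd_apply, ← hderb b hb rfl]
    simp only [Prod.snd_sum, Finset.unop_sum, LinearMap.sum_apply]
    exact Finset.sum_congr rfl fun i hi =>
      ValSplit.append (by rwa [length_raise]) hu (hb' hi)
  rw [h₁, map_sum, ← hderu u hu rfl, ← hderb b hb rfl, Finset.sum_mul_sum, Finset.sum_comm,
    ← Finset.sum_add_distrib]
  refine Finset.sum_congr rfl fun i hi => ?_
  rw [← hder _ (by simp [hu, hb' hi]) (by simp), sum_raise_append, length_raise]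
  congr 1
  exact Finset.sum_congr rfl fun j hj => wordOp_append a (hu' hj) (hb' hi)

theorem der_succ_wordVal {b v : DiffWord} (hb : weight b = -1) (hv : weight v = -1)
    (hval : ValSplit k a (b.length + v.length)) (hder : DerVal k a (b.length + v.length))
    (hderb : DerVal k a b.length) (hderv : DerVal k a v.length) :
    der k (succ (k := k) (wordVal k a b) (wordVal k a v)) =
      der k (wordVal k a b) * der k (wordVal k a v) +
        ∑ i ∈ Finset.range b.length, ∑ j ∈ Finset.range b.length,
          wordOp k a (raise j (raise i b) ++ v) := by
  have hb' {i : ℕ} (hi : i ∈ Finset.range b.length) : weight (raise i b) = 0 := by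
    rw [weight_raise (Finset.mem_range.1 hi), hb]; rfl
  have hv' {i : ℕ} (hi : i ∈ Finset.range v.length) : weight (raise i v) = 0 := by
    rw [weight_raise (Finset.mem_range.1 hi), hv]; rfl
  have h₁ : succ (k := k) (wordVal k a b) (wordVal k a v) =
      ∑ i ∈ Finset.range b.length, wordVal k a (raise i b ++ v) := by
    rw [← der_fst_apply, ← hderb b hb rfl]
    simp only [Prod.fst_sum, LinearMap.sum_apply]
    exact Finset.sum_congr rfl fun i hi =>
      ValSplit.prepend (by rwa [length_raise]) (hb' hi) hv
  rw [h₁, map_sum, ← hderv v hv rfl, ← hderb b hb rfl, Finset.sum_mul_sum,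
    ← Finset.sum_add_distrib]
  refine Finset.sum_congr rfl fun i hi => ?_
  rw [← hder _ (by simp [hv, hb' hi]) (by simp), sum_raise_append, length_raise, add_comm]
  congr 1
  exact Finset.sum_congr rfl fun j hj => wordOp_append a (hb' hi) (hv' hj)

/-- The second identity of noncommutative Novikov algebras, for words. -/
theorem sum_transfer {m : ℕ} {u b v : DiffWord} (hval : ∀ n < m, ValSplit k a n)
    (hder : ∀ n < m, DerVal k a n) (hu : weight u = -1) (hb : weight b = -1)
    (hv : weight v = -1) (hm : u.length + b.length + v.length ≤ m) :
    ∑ i ∈ Finset.range b.length, ∑ j ∈ Finset.range b.length,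
      ((wordOp k a (raise j (raise i b) ++ v)).2.unop (wordVal k a u) -
        (wordOp k a (u ++ raise j (raise i b))).1 (wordVal k a v)) = 0 := by
  have hu0 : 0 < u.length := List.length_pos_iff.2 (by rintro rfl; simp at hu)
  have hv0 : 0 < v.length := List.length_pos_iff.2 (by rintro rfl; simp at hv)
  have h₁ := der_prec_wordVal hu hb (hval _ (by omega)) (hder _ (by omega)) (hder _ (by omega))
    (hder _ (by omega))
  have h₂ := der_succ_wordVal hb hv (hval _ (by omega)) (hder _ (by omega)) (hder _ (by omega))
    (hder _ (by omega))
  replace h₁ := congrArg (fun e : OpPair k A => e.1 (wordVal k a v)) h₁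
  replace h₂ := congrArg (fun e : OpPair k A => e.2.unop (wordVal k a u)) h₂
  simp only [Prod.fst_add, Prod.fst_sum, Prod.fst_mul, LinearMap.add_apply, LinearMap.sum_apply,
    Module.End.mul_apply, der_fst_apply, Prod.snd_add, Prod.snd_sum, Prod.snd_mul,
    MulOpposite.unop_add, MulOpposite.unop_mul, Finset.unop_sum, der_snd_apply] at h₁ h₂
  have h₃ := prec_succ (k := k) (wordVal k a u) (wordVal k a b) (wordVal k a v)
  simp only [Finset.sum_sub_distrib]
  -- After cancelling $u'b'v$ and $ub'v'$, the second identity says that $ub''$ acting on $v$ from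
  -- the left equals $b''v$ acting on $u$ from the right.
  linear_combination (norm := abel) h₁ - h₂ - h₃

theorem Transfers.of_take_eq_zero {m i : ℕ} {z : DiffWord} (hval : ∀ n < m, ValSplit k a n)
    (h : ∀ z' : DiffWord, weight z' = 1 → z'.length < z.length → Transfers k a m z')
    (hz : weight z = 1) (hi : 0 < i) (hzi : weight (z.take i) = 0) : Transfers k a m z := by
  have hw := weight_take_add_weight_drop i z
  have hl : 0 < z.length := List.length_pos_iff.2 (by rintro rfl; simp at hz)
  rw [← List.take_append_drop i z]
  exact (h _ (by omega) (by rw [List.length_drop]; omega)).prepend hval (by omega) hzi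

theorem Transfers.of_take_eq_one {m i : ℕ} {z : DiffWord} (hval : ∀ n < m, ValSplit k a n)
    (h : ∀ z' : DiffWord, weight z' = 1 → z'.length < z.length → Transfers k a m z')
    (hz : weight z = 1) (hi : i < z.length) (hzi : weight (z.take i) = 1) :
    Transfers k a m z := by
  have hw := weight_take_add_weight_drop i z
  rw [← List.take_append_drop i z]
  exact (h _ hzi (by rw [List.length_take]; omega)).append hval hzi (by omega)

/-- Induction on the order of the letter at `c`. If $z$ has a nonempty prefix of weight $0$ ending
at `c`, or a proper prefix of weight $1$ ending just after it, a shorter factor remains. Otherwise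
$z$ is one term of a second derivative $b''$, whose sum transfers by `sum_transfer` and whose other
terms are already known to transfer. -/
theorem transfers_of_center {m : ℕ} (hval : ∀ n < m, ValSplit k a n)
    (hder : ∀ n < m, DerVal k a n) {z : DiffWord} {c : ℕ}
    (h : ∀ z' : DiffWord, weight z' = 1 → z'.length < z.length → Transfers k a m z')
    (hz : weight z = 1) (hc : weight (z.take c) ≤ 0) (hc' : 1 ≤ weight (z.take (c + 1))) :
    Transfers k a m z := by
  induction hn : z.getD c 0 using Nat.strong_induction_on generalizing z with
  | _ n ih =>
  have hcl : c < z.length := by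
    by_contra hcl
    rw [List.take_of_length_le (by omega)] at hc
    omega
  have hsucc := weight_take_succ hcl
  by_cases h₀ : 0 < c ∧ weight (z.take c) = 0
  · exact .of_take_eq_zero hval h hz h₀.1 h₀.2
  by_cases h₁ : c + 1 < z.length ∧ weight (z.take (c + 1)) = 1
  · exact .of_take_eq_one hval h hz h₁.1 h₁.2
  have hc0 : c = 0 ∨ weight (z.take c) ≤ -1 := by omega
  have hc1 : c + 1 = z.length ∨ 2 ≤ weight (z.take (c + 1)) := by omega
  have hend : weight (z.take z.length) = 1 := by rw [List.take_length, hz]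
  have hn2 : 2 ≤ z.getD c 0 := by
    rcases hc0 with rfl | hc0
    · have : weight (z.take 0) = 0 := by simp
      rcases hc1 with hc1 | hc1
      · rw [hc1] at hsucc; omega
      · omega
    · omega
  -- Lowering twice gives weight $1-2=-1$; `z` is the term $i=j=c$ of the second derivative of `b`.
  set b := lower c (lower c z) with hbdef
  have hlow : 1 ≤ (lower c z).getD c 0 := by rw [getD_lower_self]; omega
  have hbl : b.length = z.length := by simp [hbdef]
  have hb (i : ℕ) : weight (b.take i) = weight (z.take i) - if c < i then 2 else 0 := by
    rw [hbdef, weight_take_lower hlow, weight_take_lower (by omega)]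
    split_ifs <;> omega
  have hbw : weight b = -1 := by
    have := hb z.length
    rw [← hbl, List.take_length, hbl, hend, if_pos hcl] at this
    omega
  intro u v hu hv hm
  have hsum := sum_transfer hval hder hu hbw hv (by omega)
  have hzb : raise c (raise c b) = z := by
    rw [hbdef, raise_lower hlow, raise_lower (by omega)]
  -- In every other term, either the prefix before `c` has risen to weight exactly $1$, or the
  -- prefix through `c` has fallen to exactly $0$, or the signs persist and the letter at `c` has
  -- smaller order.
  have hother (i j : ℕ) (hi : i < z.length) (hj : j < z.length) (hij : ¬ (i = c ∧ j = c)) :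
      Transfers k a m (raise j (raise i b)) := by
    have ht (l : ℕ) : weight ((raise j (raise i b)).take l) = weight (z.take l) -
        (if c < l then 2 else 0) + (if i < l then 1 else 0) + if j < l then 1 else 0 := by
      rw [weight_take_raise (by simpa [hbl] using hj), weight_take_raise (by rwa [hbl]), hb]
    have htl : (raise j (raise i b)).length = z.length := by simp [hbl]
    have htw : weight (raise j (raise i b)) = 1 := by
      have := ht z.length
      rw [← htl, List.take_length, htl, hend, if_pos hcl, if_pos hi, if_pos hj] at this
      omega
    rw [← htl] at h
    by_cases h₂ : 1 ≤ weight ((raise j (raise i b)).take c)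
    · refine .of_take_eq_one hval h htw (htl ▸ hcl) ?_
      rw [ht] at h₂ ⊢
      rcases hc0 with rfl | hc0
      · simp at h₂
      · split_ifs at h₂ ⊢ <;> omega
    by_cases h₃ : weight ((raise j (raise i b)).take (c + 1)) ≤ 0
    · refine .of_take_eq_zero (i := c + 1) hval h htw (by omega) ?_
      rcases hc1 with hc1 | hc1
      · rw [hc1, ← htl, List.take_length] at h₃
        omega
      · rw [ht] at h₃ ⊢
        split_ifs at h₃ ⊢ <;> omega
    refine ih _ ?_ h htw (by omega) (by omega) rfl
    have hbc : b.getD c 0 = z.getD c 0 - 1 - 1 := by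
      rw [hbdef, getD_lower_self, getD_lower_self]
    have hcb : c < b.length := by omega
    rcases eq_or_ne j c with rfl | hjc
    · rw [getD_raise_self (by simpa using hcb), getD_raise_of_ne (by omega)]
      omega
    · rw [getD_raise_of_ne (Ne.symm hjc)]
      rcases eq_or_ne i c with rfl | hic
      · rw [getD_raise_self hcb]
        omega
      · rw [getD_raise_of_ne (Ne.symm hic)]
        omega
  have hcb : c ∈ Finset.range b.length := by simpa [hbl] using hcl
  rw [Finset.sum_eq_single_of_mem c hcb, Finset.sum_eq_single_of_mem c hcb, hzb] at hsum
  · exact sub_eq_zero.1 hsum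
  · intro j hj hjc
    rw [Finset.mem_range, hbl] at hj
    exact sub_eq_zero.2 (hother c j hcl hj (by tauto) u v hu hv (by simp [hbl]; omega))
  · intro i hi hic
    rw [Finset.mem_range, hbl] at hi
    refine Finset.sum_eq_zero fun j hj => ?_
    rw [Finset.mem_range, hbl] at hj
    exact sub_eq_zero.2 (hother i j hi hj (by tauto) u v hu hv (by simp [hbl]; omega))

theorem transfers {m : ℕ} (hval : ∀ n < m, ValSplit k a n) (hder : ∀ n < m, DerVal k a n)
    {z : DiffWord} (hz : weight z = 1) : Transfers k a m z := by
  classical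
  induction hn : z.length using Nat.strong_induction_on generalizing z with
  | _ n ih =>
  have hex : ∃ i, 1 ≤ weight (z.take i) := ⟨z.length, by rw [List.take_length, hz]⟩
  obtain ⟨c, hc⟩ : ∃ c, Nat.find hex = c + 1 := by
    refine Nat.exists_eq_succ_of_ne_zero fun h0 => ?_
    have := Nat.find_spec hex
    rw [h0] at this
    simp at this
  have hspec := Nat.find_spec hex
  have hmin := Nat.find_min hex (m := c) (by omega)
  rw [hc] at hspec
  exact transfers_of_center hval hder (fun z' hz' hl => ih _ (hn ▸ hl) hz' rfl) hz (by omega)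
    hspec

/-- `wordVal` marks the leftmost admissible $x$. The factor between it and any other admissible $x$
has weight $1$, and changing the mark amounts to transferring this factor from one side to the
other. -/
theorem valSplit_of_lt {m : ℕ} (hval : ∀ n < m, ValSplit k a n)
    (hder : ∀ n < m, DerVal k a n) : ValSplit k a m := by
  intro u v hu hv hm
  have hb : weight (u ++ 0 :: v) = -1 := by simp [hu, hv]
  obtain ⟨hlt, h₁, h₂, h₃, h₄⟩ := firstNeg_spec hb
  rw [wordVal]
  set i := firstNeg (u ++ 0 :: v) with hi
  have hiu : i ≤ u.length := by
    by_contra hiu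
    have := h₄ u.length (by omega)
    rw [List.take_length_add_append] at this
    simp [hu] at this
  rcases hiu.eq_or_lt with hiu | hiu
  · rw [hiu, List.take_left, List.drop_length_add_append]
    simp
  · rw [List.take_append_of_le_length hiu.le] at h₁ ⊢
    rw [List.drop_append_of_le_length hiu] at h₃ ⊢
    have hget : u.getD i 0 = 0 := by
      rw [List.getD_append _ _ _ _ hiu] at h₂
      exact h₂
    have hz : weight (u.drop (i + 1)) = 1 := by
      simp [hv] at h₃
      omega
    have hu' := eq_take_append_cons_drop hiu
    rw [hget] at hu'
    have hul : u.length = i + (u.drop (i + 1)).length + 1 := by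
      rw [List.length_drop]; omega
    have hil : (u.take i).length = i := by rw [List.length_take]; omega
    have h := transfers hval hder hz (u.take i ++ [0]) (0 :: v) (by simp [h₁]) (by simp [hv])
      (by simp only [List.length_append, List.length_cons, List.length_nil]; omega)
    rw [hval (i + 1) (by omega) (u.take i) [] h₁ rfl (by simp; omega),
      ← List.nil_append (0 :: v), hval (v.length + 1) (by omega) [] v rfl hv (by simp),
      List.nil_append, List.append_assoc, List.singleton_append, ← hu'] at h
    have hc := left_right_comm (wordOp_mem (k := k) a h₁) (wordOp_mem a h₃) a
    simp only [wordOp_nil, Prod.snd_one, MulOpposite.unop_one, Module.End.one_apply,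
      Prod.fst_one] at h
    rw [hc, h]

/-- If $b=uxv$ with $u,v$ nonempty of weight $0$, then `der_left_right` reduces to the shorter words
$ux$, $x$, $xv$. Otherwise differentiating a suitable letter of $b$ gives an unsplittable word
centered at that letter, and the claim is the equation that defines its operator. -/
theorem derVal_of_lt {m : ℕ} (hval : ∀ n ≤ m, ValSplit k a n)
    (hder : ∀ n < m, DerVal k a n) : DerVal k a m := by
  classical
  intro b hb hm
  have hb0 : 0 < b.length := List.length_pos_iff.2 (by rintro rfl; simp at hb)
  by_cases hs : ∃ i, 0 < i ∧ i + 1 < b.length ∧ weight (b.take i) = 0 ∧ b.getD i 0 = 0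
  · obtain ⟨i, hi, hil, hw, hget⟩ := hs
    have hbe := eq_take_append_cons_drop (u := b) (i := i) (by omega)
    rw [hget] at hbe
    generalize hu : b.take i = u at *
    generalize hv : b.drop (i + 1) = v at *
    have hul : 0 < u.length := by rw [← hu, List.length_take]; omega
    have hvl : 0 < v.length := by rw [← hv, List.length_drop]; omega
    subst hbe
    have hvw : weight v = 0 := by simp [hw] at hb; omega
    simp only [List.length_append, List.length_cons] at hm
    have hu' {i : ℕ} (hi : i ∈ Finset.range u.length) : weight (raise i u) = 1 := by
      rw [weight_raise (Finset.mem_range.1 hi), hw]; rfl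
    have hv' {i : ℕ} (hi : i ∈ Finset.range v.length) : weight (raise i v) = 1 := by
      rw [weight_raise (Finset.mem_range.1 hi), hvw]; rfl
    have h₁ := hder (u.length + 1) (by omega) (u ++ [0]) (by simp [hw]) (by simp)
    have h₂ := hder (v.length + 1) (by omega) (0 :: v) (by simp [hvw]) (by simp)
    have h₃ := hder 1 (by omega) [0] rfl rfl
    have h₀ := hval 1 (by omega) [] [] rfl rfl rfl
    simp only [List.nil_append, wordOp_nil, Prod.snd_one, MulOpposite.unop_one,
      Module.End.one_apply, Prod.fst_one] at h₀
    have h₄ := hval (v.length + 1) (by omega) [] v rfl hvw (by simp)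
    simp only [List.nil_append, wordOp_nil, Module.End.one_apply, Prod.fst_one] at h₄
    have h₅ := hval (u.length + 1) (by omega) u [] hw rfl (by simp)
    simp only [wordOp_nil, Module.End.one_apply, Prod.snd_one, MulOpposite.unop_one] at h₅
    rw [hval m le_rfl u v hw hvw (by omega),
      der_left_right (wordOp_mem a hw) (wordOp_mem a hvw), ← h₅, ← h₄, ← h₁, ← h₂]
    rw [h₀] at h₃
    rw [← h₃, ← List.singleton_append (x := 0) (l := v)]
    simp only [sum_raise_append, List.length_singleton, Finset.sum_range_one, raise_zero_cons,
      zero_add, Finset.sum_mul, Finset.mul_sum, add_mul, mul_add]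
    have e₁ : ∑ j ∈ Finset.range u.length, wordOp k a (raise j u ++ ([0] ++ v)) =
        ∑ j ∈ Finset.range u.length, wordOp k a (raise j u ++ [0]) * wordOp k a v :=
      Finset.sum_congr rfl fun j hj => by
        rw [← List.append_assoc, wordOp_append a (by simp [hu' hj]) hvw]
    have e₂ : ∑ j ∈ Finset.range v.length, wordOp k a (u ++ ([0] ++ raise j v)) =
        ∑ j ∈ Finset.range v.length, wordOp k a u * wordOp k a ([0] ++ raise j v) :=
      Finset.sum_congr rfl fun j hj => wordOp_append a hw (by simp [hv' hj])
    have e₃ : wordOp k a (u ++ ([1] ++ v)) = wordOp k a u * wordOp k a [1] * wordOp k a v := by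
      rw [wordOp_append a hw (by simp [hvw]), wordOp_append a rfl hvw, mul_assoc]
    have e₄ : wordOp k a (u ++ [1]) = wordOp k a u * wordOp k a [1] :=
      wordOp_append a hw rfl
    have e₅ : wordOp k a ([1] ++ v) = wordOp k a [1] * wordOp k a v :=
      wordOp_append a rfl hvw
    have e₆ := sum_raise_append (fun w => wordOp k a (u ++ w)) [0] v
    simp only [List.length_singleton, Finset.sum_range_one, raise_zero_cons, zero_add] at e₆
    rw [e₁, e₆, e₂, e₃, e₄, e₅, mul_assoc]
    abel
  · push Not at hs
    obtain ⟨c, hcl, hc, hc'⟩ : ∃ c < b.length, (∀ i < c, weight (b.take (i + 1)) < 0) ∧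
        (c + 1 = b.length ∨ 0 ≤ weight (b.take (c + 1))) := by
      by_cases hex : ∃ i, i < b.length ∧ 0 ≤ weight (b.take (i + 1))
      · refine ⟨Nat.find hex, (Nat.find_spec hex).1, fun i hi => ?_,
          Or.inr (Nat.find_spec hex).2⟩
        have := (Nat.find_spec hex).1
        by_contra hi'
        exact Nat.find_min hex hi ⟨by omega, by omega⟩
      · refine ⟨b.length - 1, by omega, fun i hi => ?_, Or.inl (by omega)⟩
        by_contra hi'
        exact hex ⟨i, by omega, by omega⟩
    have htake := weight_take_raise hcl
    have hw : weight (raise c b) = 0 := by rw [weight_raise hcl, hb]; rfl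
    have hlast : weight (b.take b.length) = -1 := by rw [List.take_length, hb]
    have hcenter : center (raise c b) = c := by
      refine center_eq ?_ fun i hi => ?_
      · rw [htake, if_pos (by omega)]
        rcases hc' with hc' | hc'
        · rw [hc', hlast]; rfl
        · omega
      · rw [htake, if_neg (by omega), add_zero]
        exact hc i hi
    -- Weights fall by at most one per letter, and a fall from $0$ to $-1$ needs a letter $x$ after
    -- a prefix of weight $0$, which `hs` excludes.
    have hpos : ∀ i, c + 1 ≤ i → i < b.length → 0 ≤ weight (b.take i) := by
      intro i hi
      induction i, hi using Nat.le_induction with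
      | base => intro; omega
      | succ i hi ih =>
        intro hil
        have h₀ := ih (by omega)
        have h₁ := hs i (by omega) hil
        have h₂ := weight_take_succ (u := b) (i := i) (by omega)
        omega
    have hns : ¬ (raise c b).Splits := by
      rintro ⟨i, hi, hil, hi0⟩
      rw [length_raise] at hil
      rw [htake] at hi0
      rcases Nat.lt_or_ge c i with hci | hci
      · have := hpos i hci hil
        rw [if_pos hci] at hi0
        omega
      · have := hc (i - 1) (by omega)
        rw [Nat.sub_add_cancel hi] at this
        rw [if_neg (by omega)] at hi0
        omega
    have hne : raise c b ≠ [] := by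
      intro h
      have := congrArg List.length h
      rw [length_raise, List.length_nil] at this
      omega
    have h := wordOp_of_not_splits (k := k) a hw hne hns
    rw [hcenter, lower_raise, length_raise] at h
    rw [← Finset.add_sum_erase _ _ (Finset.mem_range.2 hcl), h, sub_add_cancel]

theorem valSplit_and_derVal (m : ℕ) : ValSplit k a m ∧ DerVal k a m := by
  induction m using Nat.strong_induction_on with
  | _ m ih =>
  have h := valSplit_of_lt (fun n hn => (ih n hn).1) fun n hn => (ih n hn).2
  exact ⟨h, derVal_of_lt
    (fun n hn => hn.eq_or_lt.elim (fun e => e ▸ h) fun hn => (ih n hn).1) fun n hn => (ih n hn).2⟩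

variable (a)

theorem prec_wordVal {u v : DiffWord} (hu : weight u = -1) (hv : weight v = -1) :
    prec (k := k) (wordVal k a u) (wordVal k a v) =
      ∑ j ∈ Finset.range v.length, wordVal k a (u ++ raise j v) := by
  rw [← der_snd_apply, ← (valSplit_and_derVal _).2 v hv rfl]
  simp only [Prod.snd_sum, Finset.unop_sum, LinearMap.sum_apply]
  refine Finset.sum_congr rfl fun j hj => (valSplit_and_derVal _).1.append hu ?_
  rw [weight_raise (Finset.mem_range.1 hj), hv]; rfl

theorem succ_wordVal {u v : DiffWord} (hu : weight u = -1) (hv : weight v = -1) :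
    succ (k := k) (wordVal k a u) (wordVal k a v) =
      ∑ j ∈ Finset.range u.length, wordVal k a (raise j u ++ v) := by
  rw [← der_fst_apply, ← (valSplit_and_derVal _).2 u hu rfl]
  simp only [Prod.fst_sum, LinearMap.sum_apply]
  refine Finset.sum_congr rfl fun j hj => (valSplit_and_derVal _).1.prepend ?_ hv
  rw [weight_raise (Finset.mem_range.1 hj), hu]; rfl

theorem wordVal_x : wordVal k a [0] = a := by
  have h := (valSplit_and_derVal (k := k) (a := a) 1).1 [] [] rfl rfl rfl
  simpa using h

end NCNovikov

/-! ### The free differential algebra and its map to an arbitrary Novikov algebra -/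

/-- The free associative algebra with derivation on one generator. -/
abbrev DiffPoly (k : Type*) [Field k] : Type _ := DiffWord →₀ k

namespace DiffPoly

open DiffWord

variable (k : Type*) [Field k]

/-- The product. -/
noncomputable def mul : DiffPoly k →ₗ[k] DiffPoly k →ₗ[k] DiffPoly k :=
  Finsupp.linearCombination k fun u : DiffWord =>
    Finsupp.linearCombination k fun v : DiffWord => Finsupp.single (u ++ v) (1 : k)

/-- The derivation. -/
noncomputable def d : DiffPoly k →ₗ[k] DiffPoly k :=
  Finsupp.linearCombination k fun u : DiffWord =>
    ∑ j ∈ Finset.range u.length, Finsupp.single (raise j u) (1 : k)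

@[simp] theorem mul_single (u v : DiffWord) :
    mul k (Finsupp.single u 1) (Finsupp.single v 1) = Finsupp.single (u ++ v) 1 := by
  simp [mul]

@[simp] theorem d_single (u : DiffWord) :
    d k (Finsupp.single u 1) = ∑ j ∈ Finset.range u.length, Finsupp.single (raise j u) 1 := by
  simp [d]

variable {k}

theorem mul_assoc' (f g h : DiffPoly k) : mul k (mul k f g) h = mul k f (mul k g h) := by
  induction f using Finsupp.induction_linear with
  | zero => simp
  | add f₁ f₂ h₁ h₂ => simp [h₁, h₂]
  | single u r =>
  induction g using Finsupp.induction_linear with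
  | zero => simp
  | add f₁ f₂ h₁ h₂ => simp [h₁, h₂]
  | single v s =>
  induction h using Finsupp.induction_linear with
  | zero => simp
  | add f₁ f₂ h₁ h₂ => simp [h₁, h₂]
  | single w t =>
  simp [← Finsupp.smul_single_one u r, ← Finsupp.smul_single_one v s,
    ← Finsupp.smul_single_one w t, -Finsupp.smul_single]

theorem d_mul (f g : DiffPoly k) : d k (mul k f g) = mul k (d k f) g + mul k f (d k g) := by
  induction f using Finsupp.induction_linear with
  | zero => simp
  | add f₁ f₂ h₁ h₂ => simp only [map_add, LinearMap.add_apply, h₁, h₂]; abel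
  | single u r =>
  induction g using Finsupp.induction_linear with
  | zero => simp
  | add f₁ f₂ h₁ h₂ => simp only [map_add, h₁, h₂]; abel
  | single v s =>
  rw [← Finsupp.smul_single_one u r, ← Finsupp.smul_single_one v s]
  simp only [map_smul, LinearMap.smul_apply, mul_single, d_single, map_sum, LinearMap.sum_apply,
    sum_raise_append (fun w => Finsupp.single w (1 : k)), smul_add, Finset.smul_sum]

noncomputable instance : NCNovikov k (DiffPoly k) where
  prec := (mul k).compl₂ (d k)
  succ := mul k ∘ₗ d k
  succ_prec f g h := by simp [mul_assoc']
  prec_succ f g h := by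
    simp only [LinearMap.compl₂_apply, LinearMap.comp_apply, d_mul, map_add, LinearMap.add_apply,
      mul_assoc']
    abel

theorem prec_eq (f g : DiffPoly k) : NCNovikov.prec (k := k) f g = mul k f (d k g) := rfl

theorem succ_eq (f g : DiffPoly k) : NCNovikov.succ (k := k) f g = mul k (d k f) g := rfl

/-- A property of linear combinations of words is checked on words. -/
theorem mem_of_supported {M : Type*} [AddCommGroup M] [Module k M] {s : Set DiffWord}
    (F : DiffPoly k →ₗ[k] M) (N : Submodule k M) (h : ∀ u ∈ s, F (Finsupp.single u 1) ∈ N)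
    {f : DiffPoly k} (hf : f ∈ Finsupp.supported k k s) : F f ∈ N := by
  rw [Finsupp.supported_eq_span_single] at hf
  have : Submodule.span k ((fun i => Finsupp.single i (1 : k)) '' s) ≤ N.comap F :=
    Submodule.span_le.2 (by rintro _ ⟨u, hu, rfl⟩; exact h u hu)
  exact this hf

theorem mul_mem {s t r : Set DiffWord} (h : ∀ u ∈ s, ∀ v ∈ t, u ++ v ∈ r) {f g : DiffPoly k}
    (hf : f ∈ Finsupp.supported k k s) (hg : g ∈ Finsupp.supported k k t) :
    mul k f g ∈ Finsupp.supported k k r := by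
  refine mem_of_supported ((mul k).flip g) _ (fun u hu => ?_) hf
  refine mem_of_supported (mul k (Finsupp.single u 1)) _ (fun v hv => ?_) hg
  rw [mul_single]
  exact Finsupp.single_mem_supported _ _ (h u hu v hv)

theorem d_mem {s t : Set DiffWord} (h : ∀ u ∈ s, ∀ j < u.length, raise j u ∈ t)
    {f : DiffPoly k} (hf : f ∈ Finsupp.supported k k s) :
    d k f ∈ Finsupp.supported k k t := by
  refine mem_of_supported (d k) _ (fun u hu => ?_) hf
  rw [d_single]
  exact sum_mem fun j hj => Finsupp.single_mem_supported _ _ (h u hu j (Finset.mem_range.1 hj))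

variable (k) in
/-- The generator. -/
noncomputable def X : DiffPoly k := Finsupp.single [0] 1

/-- The value of a monomial is homogeneous in the length and in the weight. -/
theorem eval_mem (t : OpMon) : t.eval k (X k) ∈
    Finsupp.supported k k {u : DiffWord | u.length = t.leaves ∧ u.weight = -1} := by
  induction t with
  | x => exact Finsupp.single_mem_supported _ _ ⟨rfl, rfl⟩
  | prec s t hs ht =>
    refine mul_mem ?_ hs (d_mem (t := {u | u.length = t.leaves ∧ u.weight = 0}) ?_ ht)
    · rintro u ⟨hu, hu'⟩ v ⟨hv, hv'⟩
      simp [OpMon.leaves, hu, hu', hv, hv']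
    · rintro u ⟨hu, hu'⟩ j hj
      simp [hu, weight_raise hj, hu']
  | succ s t hs ht =>
    refine mul_mem ?_ (d_mem (t := {u | u.length = s.leaves ∧ u.weight = 0}) ?_ hs) ht
    · rintro u ⟨hu, hu'⟩ v ⟨hv, hv'⟩
      simp [OpMon.leaves, hu, hu', hv, hv']
    · rintro u ⟨hu, hu'⟩ j hj
      simp [hu, weight_raise hj, hu']

section Realization

variable {A : Type*} [AddCommGroup A] [Module k A] [NCNovikov k A] (a : A)

open NCNovikov

variable (k) in
/-- The value of a linear combination of words of weight `-1` at an element of a noncommutative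
Novikov algebra. -/
noncomputable def toNCNovikov : DiffPoly k →ₗ[k] A :=
  Finsupp.linearCombination k (wordVal k a)

@[simp] theorem toNCNovikov_single (u : DiffWord) :
    toNCNovikov k a (Finsupp.single u 1) = wordVal k a u := by simp [toNCNovikov]

theorem toNCNovikov_prec {f g : DiffPoly k} (hf : f ∈ Finsupp.supported k k weightNegOne)
    (hg : g ∈ Finsupp.supported k k weightNegOne) :
    toNCNovikov k a (prec (k := k) f g) =
      prec (k := k) (toNCNovikov k a f) (toNCNovikov k a g) := by
  rw [← sub_eq_zero]
  refine mem_of_supported (M := A) ((toNCNovikov k a ∘ₗ (prec (k := k)).flip g) -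
    (prec (k := k)).flip (toNCNovikov k a g) ∘ₗ toNCNovikov k a) ⊥ (fun u hu => ?_) hf
  refine mem_of_supported (M := A) ((toNCNovikov k a ∘ₗ prec (k := k) (Finsupp.single u 1)) -
    prec (k := k) (toNCNovikov k a (Finsupp.single u 1)) ∘ₗ toNCNovikov k a) ⊥
    (fun v hv => ?_) hg
  simp [prec_eq, prec_wordVal a hu hv]

theorem toNCNovikov_succ {f g : DiffPoly k} (hf : f ∈ Finsupp.supported k k weightNegOne)
    (hg : g ∈ Finsupp.supported k k weightNegOne) :
    toNCNovikov k a (succ (k := k) f g) =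
      succ (k := k) (toNCNovikov k a f) (toNCNovikov k a g) := by
  rw [← sub_eq_zero]
  refine mem_of_supported (M := A) ((toNCNovikov k a ∘ₗ (succ (k := k)).flip g) -
    (succ (k := k)).flip (toNCNovikov k a g) ∘ₗ toNCNovikov k a) ⊥ (fun u hu => ?_) hf
  refine mem_of_supported (M := A) ((toNCNovikov k a ∘ₗ succ (k := k) (Finsupp.single u 1)) -
    succ (k := k) (toNCNovikov k a (Finsupp.single u 1)) ∘ₗ toNCNovikov k a) ⊥
    (fun v hv => ?_) hg
  simp [succ_eq, succ_wordVal a hu hv]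

theorem eval_mem_weightNegOne (t : OpMon) :
    t.eval k (X k) ∈ Finsupp.supported k k weightNegOne :=
  Finsupp.supported_mono (fun _ hu => hu.2) (eval_mem t)

/-- The value of a monomial in a noncommutative Novikov algebra is determined by its value in the
free associative algebra with derivation. -/
theorem toNCNovikov_eval (t : OpMon) : toNCNovikov k a (t.eval k (X k)) = t.eval k a := by
  induction t with
  | x => simp [OpMon.eval, X, wordVal_x]
  | prec s t hs ht =>
    rw [OpMon.eval, toNCNovikov_prec a (eval_mem_weightNegOne s) (eval_mem_weightNegOne t), hs,
      ht, OpMon.eval]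
  | succ s t hs ht =>
    rw [OpMon.eval, toNCNovikov_succ a (eval_mem_weightNegOne s) (eval_mem_weightNegOne t), hs,
      ht, OpMon.eval]

end Realization

end DiffPoly

/-! ### The universal property of the free algebra -/

namespace FreeNCNovikov

variable {k : Type*} [Field k]

theorem eval_gen (t : OpMon) : t.eval k (gen k) =
    (FreeTwoOp.relIdeal k).mkQ (Finsupp.single t 1) := by
  induction t with
  | x => rfl
  | prec s t hs ht =>
    rw [OpMon.eval, hs, ht]
    exact congrArg (FreeTwoOp.relIdeal k).mkQ
      (show FreeTwoOp.prec k (Finsupp.single s 1) (Finsupp.single t 1) = _ by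
        simp [FreeTwoOp.prec])
  | succ s t hs ht =>
    rw [OpMon.eval, hs, ht]
    exact congrArg (FreeTwoOp.relIdeal k).mkQ
      (show FreeTwoOp.succ k (Finsupp.single s 1) (Finsupp.single t 1) = _ by
        simp [FreeTwoOp.succ])

variable {A : Type*} [AddCommGroup A] [Module k A] [NCNovikov k A] (a : A)

theorem linearCombination_eval_prec (f g : FreeTwoOp k) :
    Finsupp.linearCombination k (OpMon.eval k a) (FreeTwoOp.prec k f g) =
      NCNovikov.prec (k := k) (Finsupp.linearCombination k (OpMon.eval k a) f)
        (Finsupp.linearCombination k (OpMon.eval k a) g) := by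
  induction f using Finsupp.induction_linear with
  | zero => simp
  | add f₁ f₂ h₁ h₂ => simp only [map_add, LinearMap.add_apply, h₁, h₂]
  | single s r =>
  induction g using Finsupp.induction_linear with
  | zero => simp
  | add f₁ f₂ h₁ h₂ => simp only [map_add, h₁, h₂]
  | single t r' =>
    rw [← Finsupp.smul_single_one s r, ← Finsupp.smul_single_one t r']
    simp [FreeTwoOp.prec, OpMon.eval, -Finsupp.smul_single]

theorem linearCombination_eval_succ (f g : FreeTwoOp k) :
    Finsupp.linearCombination k (OpMon.eval k a) (FreeTwoOp.succ k f g) =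
      NCNovikov.succ (k := k) (Finsupp.linearCombination k (OpMon.eval k a) f)
        (Finsupp.linearCombination k (OpMon.eval k a) g) := by
  induction f using Finsupp.induction_linear with
  | zero => simp
  | add f₁ f₂ h₁ h₂ => simp only [map_add, LinearMap.add_apply, h₁, h₂]
  | single s r =>
  induction g using Finsupp.induction_linear with
  | zero => simp
  | add f₁ f₂ h₁ h₂ => simp only [map_add, h₁, h₂]
  | single t r' =>
    rw [← Finsupp.smul_single_one s r, ← Finsupp.smul_single_one t r']
    simp [FreeTwoOp.succ, OpMon.eval, -Finsupp.smul_single]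

theorem relIdeal_le_ker :
    FreeTwoOp.relIdeal k ≤ LinearMap.ker (Finsupp.linearCombination k (OpMon.eval k a)) := by
  refine sInf_le ⟨⟨?_, ?_, ?_, ?_⟩, ?_, ?_⟩
  · intro f g h
    rw [LinearMap.mem_ker] at h ⊢
    rw [linearCombination_eval_prec, h, map_zero, LinearMap.zero_apply]
  · intro f g h
    rw [LinearMap.mem_ker] at h ⊢
    rw [linearCombination_eval_prec, h, map_zero]
  · intro f g h
    rw [LinearMap.mem_ker] at h ⊢
    rw [linearCombination_eval_succ, h, map_zero, LinearMap.zero_apply]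
  · intro f g h
    rw [LinearMap.mem_ker] at h ⊢
    rw [linearCombination_eval_succ, h, map_zero]
  · intro f g h
    simp only [LinearMap.mem_ker, map_sub, linearCombination_eval_succ,
      linearCombination_eval_prec, NCNovikov.succ_prec, sub_self]
  · intro f g h
    simp only [LinearMap.mem_ker, map_sub, linearCombination_eval_succ,
      linearCombination_eval_prec, NCNovikov.prec_succ, sub_self]

/-- The homomorphism from the free noncommutative Novikov algebra given by the image of the
generator. -/
noncomputable def lift : FreeNCNovikov k →ₗ[k] A :=
  (FreeTwoOp.relIdeal k).liftQ _ (relIdeal_le_ker a)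

theorem lift_eval (t : OpMon) : lift a (t.eval k (gen k)) = t.eval k a := by
  rw [eval_gen, lift, Submodule.mkQ_apply, Submodule.liftQ_apply]
  simp

theorem span_range_eval_gen :
    Submodule.span k (Set.range fun t : OpMon => t.eval k (gen k)) = ⊤ := by
  refine eq_top_iff.2 fun z _ => ?_
  obtain ⟨f, rfl⟩ := Submodule.mkQ_surjective _ z
  induction f using Finsupp.induction_linear with
  | zero => simp
  | add f g hf hg => rw [map_add]; exact add_mem (hf trivial) (hg trivial)
  | single t r =>
    rw [← Finsupp.smul_single_one, map_smul, ← eval_gen]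
    exact Submodule.smul_mem _ _ (Submodule.subset_span ⟨t, rfl⟩)

end FreeNCNovikov

namespace DiffWord

/-! ### The order on words

A word is read from the left with a counter `b` of the letters `x` available as operands, and a
stack `cs` of the numbers of operands on the right that the pending letters still wait for. -/

/-- A new operand is read. -/
def addZero : ℕ → List ℕ → ℕ × List ℕ
  | b, [] => (b + 1, [])
  | b, c :: cs => if b + 1 = c then addZero 0 cs else (b + 1, c :: cs)

/-- The letter `x^(m)` is read. -/
def step (σ : ℕ × List ℕ) (m : ℕ) : ℕ × List ℕ :=
  if m = 0 then addZero σ.1 σ.2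
  else if m ≤ σ.1 then (σ.1 - m + 1, σ.2)
  else (0, (m - σ.1) :: σ.2)

/-- A word is read. -/
def run (σ : ℕ × List ℕ) (u : DiffWord) : ℕ × List ℕ := u.foldl step σ

/-- The rank of the letter `x^(m)` when `b` operands are available. -/
def rank (b m : ℕ) : ℕ := if m ≤ b then b - m else m

/-- The sequence of the ranks of the letters of a word. -/
def key : ℕ × List ℕ → DiffWord → List ℕ
  | _, [] => []
  | σ, m :: u => rank σ.1 m :: key (step σ m) u

/-- The operands of a letter fit into the state: `p` operands on the left do not complete a
pending letter, and operands on the right are used only if none is available on the left. -/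
def Fits (b : ℕ) (cs : List ℕ) (p q : ℕ) : Prop := (∀ c ∈ cs.head?, b + p < c) ∧ (q = 0 ∨ b = 0)

/-- The word `x^p x^(p+q) x^q`. -/
def corolla (p q : ℕ) : DiffWord := List.replicate p 0 ++ (p + q) :: List.replicate q 0

/-- `rank b` reverses $0,\dots,b$ and fixes larger numbers. Injectivity means that words with equal
initial keys have equal initial letters, hence are read into the same state. -/
theorem rank_injective (b : ℕ) : Function.Injective (rank b) := by
  intro m n h
  simp only [rank] at h
  split_ifs at h <;> omega

@[simp] theorem run_nil (σ : ℕ × List ℕ) : run σ [] = σ := rfl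

@[simp] theorem run_cons (σ : ℕ × List ℕ) (m : ℕ) (u : DiffWord) :
    run σ (m :: u) = run (step σ m) u := rfl

theorem run_append (σ : ℕ × List ℕ) (u v : DiffWord) : run σ (u ++ v) = run (run σ u) v :=
  List.foldl_append

theorem key_append_lt_key_append {σ : ℕ × List ℕ} {u v : DiffWord} (hl : u.length = v.length)
    (h : key σ u < key σ v) (r s : DiffWord) : key σ (u ++ r) < key σ (v ++ s) := by
  induction u generalizing v σ with
  | nil => cases v with
    | nil => simp [key] at h
    | cons => simp at hl
  | cons m u ih => cases v with
    | nil => simp at hl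
    | cons n v =>
      simp only [List.cons_append, key, List.cons_lt_cons_iff] at h ⊢
      rcases h with h | ⟨h, h'⟩
      · exact Or.inl h
      · obtain rfl := rank_injective _ h
        exact Or.inr ⟨rfl, ih (by simpa using hl) h'⟩

theorem key_append_lt_iff {σ : ℕ × List ℕ} (s u v : DiffWord) :
    key σ (s ++ u) < key σ (s ++ v) ↔ key (run σ s) u < key (run σ s) v := by
  induction s generalizing σ with
  | nil => rfl
  | cons m s ih => simp [key, ih]

theorem key_append_lt_cases {σ : ℕ × List ℕ} {u v r s : DiffWord} (hl : u.length = v.length)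
    (h : key σ (u ++ r) < key σ (v ++ s)) :
    key σ u < key σ v ∨ u = v ∧ key (run σ v) r < key (run σ v) s := by
  induction u generalizing v σ with
  | nil =>
    obtain rfl : v = [] := List.length_eq_zero_iff.1 hl.symm
    exact Or.inr ⟨rfl, h⟩
  | cons m u ih => cases v with
    | nil => simp at hl
    | cons n v =>
      simp only [List.cons_append, key, List.cons_lt_cons_iff] at h ⊢
      rcases h with h | ⟨h, h'⟩
      · exact Or.inl (Or.inl h)
      · obtain rfl := rank_injective _ h
        rcases ih (by simpa using hl) h' with h'' | ⟨rfl, h''⟩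
        · exact Or.inl (Or.inr ⟨rfl, h''⟩)
        · exact Or.inr ⟨rfl, h''⟩

theorem addZero_of_lt {b : ℕ} {cs : List ℕ} (h : ∀ c ∈ cs.head?, b + 1 < c) :
    addZero b cs = (b + 1, cs) := by
  cases cs with
  | nil => rfl
  | cons c cs =>
    have := h c (by simp)
    rw [addZero, if_neg (by omega)]

theorem run_replicate {b p : ℕ} {cs : List ℕ} (h : ∀ c ∈ cs.head?, b + p < c) :
    run (b, cs) (List.replicate p 0) = (b + p, cs) := by
  induction p generalizing b with
  | zero => rfl
  | succ p ih =>
    rw [List.replicate_succ, run_cons, step, if_pos rfl,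
      addZero_of_lt fun c hc => by have := h c hc; omega,
      ih fun c hc => by have := h c hc; omega]
    congr 1
    omega

/-- Reading `x^p x^(p+q) x^q` amounts to reading `x`. -/
theorem run_corolla {b p q : ℕ} {cs : List ℕ} (h : Fits b cs p q) (hpq : 1 ≤ p + q) :
    run (b, cs) (corolla p q) = step (b, cs) 0 := by
  rw [corolla, run_append, run_replicate h.1, run_cons, step, if_neg (by omega)]
  rcases Nat.eq_zero_or_pos q with rfl | hq
  · rw [if_pos (by simp)]
    rw [step, if_pos rfl, addZero_of_lt fun c hc => by have := h.1 c hc; omega]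
    simp
  · obtain rfl : b = 0 := h.2.resolve_left (by omega)
    obtain ⟨q, rfl⟩ : ∃ n, q = n + 1 := ⟨q - 1, by omega⟩
    rw [if_neg (by simp), List.replicate_succ', run_append, run_replicate (by simp)]
    simp [step, addZero]

/-- Compare at the first deviation from $x^px^{(K)}x^q$. Before position $p$, the prefix bound keeps
a positive letter within the available operands, so its rank is below that of $x$. At position $p$
there are two cases: if $q=0$, the letter must be $x^{(K+m)}$, whose operands are all available and
whose rank is lower because $m>0$; if $b+p<K$, then $K$ is its own rank and every smaller letter
ranks lower. -/
theorem key_lt_key_corolla {b p q K m : ℕ} {cs : List ℕ} {y : DiffWord}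
    (hcs : ∀ c ∈ cs.head?, b + p < c) (hl : y.length = p + 1 + q) (hsum : y.sum = K + m)
    (hpre : ∀ t < p, (y.take (t + 1)).sum ≤ b + t)
    (h : q = 0 ∧ K + m ≤ b + p ∧ (0 < m ∨ y.getD p 0 < K) ∨ b + p < K ∧ y.getD p 0 < K)
    (r s : DiffWord) :
    key (b, cs) (y ++ r) <
      key (b, cs) ((List.replicate p 0 ++ K :: List.replicate q 0) ++ s) := by
  induction p generalizing b y with
  | zero =>
    cases y with
    | nil => simp at hl; omega
    | cons n y =>
      rw [List.replicate_zero, List.nil_append, List.cons_append, List.cons_append, key, key,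
        List.cons_lt_cons_iff]
      left
      simp only [rank, List.getD_cons_zero] at h ⊢
      rcases h with ⟨rfl, hK, hm⟩ | ⟨hK, hn⟩
      · obtain rfl : y = [] := by
          rw [← List.length_eq_zero_iff]
          simp at hl
          simpa using hl
        simp at hsum
        rw [if_pos (by omega), if_pos (by omega)]
        omega
      · rw [if_neg (by omega : ¬ K ≤ b)]
        split_ifs <;> omega
  | succ p ih =>
    cases y with
    | nil => simp at hl; omega
    | cons n y =>
      have hn := hpre 0 (by omega)
      simp at hn
      rw [List.replicate_succ, List.cons_append, List.cons_append, List.cons_append, key, key,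
        List.cons_lt_cons_iff]
      rcases Nat.eq_zero_or_pos n with rfl | hn0
      · right
        refine ⟨rfl, ?_⟩
        rw [step, if_pos rfl, addZero_of_lt fun c hc => by have := hcs c hc; omega]
        refine ih (fun c hc => by have := hcs c hc; omega) (by simp at hl; omega)
          (by simpa using hsum) (fun t ht => ?_) ?_
        · have := hpre (t + 1) (by omega)
          simp at this
          omega
        · rw [List.getD_cons_succ] at h
          rcases h with h | h
          · exact Or.inl ⟨h.1, by omega, h.2.2⟩
          · right; exact ⟨by omega, h.2⟩
      · left
        simp only [rank]
        rw [if_pos hn, if_pos (Nat.zero_le _)]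
        omega

/-! ### Words without reducible subwords -/

/-- The words all of whose letters are still available or pending when they are read. -/
inductive Unreduced : DiffWord → ℕ → List ℕ → Prop
  | nil : Unreduced [] 0 []
  | zero {s : DiffWord} {b : ℕ} {cs : List ℕ} (h : Unreduced s b cs)
      (hc : ∀ c ∈ cs.head?, b + 1 < c) : Unreduced (s ++ [0]) (b + 1) cs
  | push {s : DiffWord} {b m : ℕ} {cs : List ℕ} (h : Unreduced s b cs) (hm : b < m) :
      Unreduced (s ++ [m]) 0 ((m - b) :: cs)

namespace Unreduced

variable {s : DiffWord} {b : ℕ} {cs : List ℕ}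

theorem run_eq (h : Unreduced s b cs) : run (0, []) s = (b, cs) := by
  induction h with
  | nil => rfl
  | zero h hc ih => rw [run_append, ih, run_cons, run_nil, step, if_pos rfl, addZero_of_lt hc]
  | push h hm ih =>
    rw [run_append, ih, run_cons, run_nil, step, if_neg (by omega), if_neg (by simpa using hm)]

theorem lt_head (h : Unreduced s b cs) : ∀ c ∈ cs.head?, b < c := by
  cases h with
  | nil => simp
  | zero h hc => exact fun c hc' => hc c hc'
  | push h hm => simpa using hm

theorem exists_replicate (h : Unreduced s b cs) :
    ∃ s₀, s = s₀ ++ List.replicate b 0 ∧ Unreduced s₀ 0 cs := by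
  induction h with
  | nil => exact ⟨[], rfl, .nil⟩
  | zero h hc ih =>
    obtain ⟨s₀, rfl, h₀⟩ := ih
    exact ⟨s₀, by rw [List.replicate_succ', List.append_assoc], h₀⟩
  | push h hm => exact ⟨_, by simp, h.push hm⟩

theorem append_replicate (h : Unreduced s b cs) {p : ℕ} (hp : ∀ c ∈ cs.head?, b + p < c) :
    Unreduced (s ++ List.replicate p 0) (b + p) cs := by
  induction p with
  | zero => simpa using h
  | succ p ih =>
    rw [List.replicate_succ', ← List.append_assoc]
    exact (ih fun c hc => by have := hp c hc; omega).zero hp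

theorem exists_push {c : ℕ} {s₀ : DiffWord} (h : Unreduced s₀ 0 (c :: cs)) :
    ∃ s₁ b₁, s₀ = s₁ ++ List.replicate b₁ 0 ++ [b₁ + c] ∧ Unreduced s₁ 0 cs ∧
      ∀ c' ∈ cs.head?, b₁ < c' := by
  cases h with
  | push h hm =>
    obtain ⟨s₁, rfl, h₁⟩ := h.exists_replicate
    exact ⟨s₁, _, by rw [Nat.add_sub_cancel' hm.le], h₁, h.lt_head⟩

theorem take (h : Unreduced s b cs) (i : ℕ) : ∃ b' cs', Unreduced (s.take i) b' cs' := by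
  induction h generalizing i with
  | nil => exact ⟨0, [], by simpa using .nil⟩
  | @zero s b cs h hc ih =>
    rcases Nat.lt_or_ge s.length i with hi | hi
    · rw [List.take_of_length_le (by simp; omega)]
      exact ⟨_, _, h.zero hc⟩
    · rw [List.take_append_of_le_length hi]
      exact ih i
  | @push s b m cs h hm ih =>
    rcases Nat.lt_or_ge s.length i with hi | hi
    · rw [List.take_of_length_le (by simp; omega)]
      exact ⟨_, _, h.push hm⟩
    · rw [List.take_append_of_le_length hi]
      exact ih i

theorem length_eq_of_nil (h : Unreduced s b []) : s.length = b := by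
  generalize hcs : ([] : List ℕ) = cs at h
  induction h with
  | nil => rfl
  | zero h hc ih => simp [ih hcs]
  | push => simp at hcs

@[simp] theorem _root_.DiffWord.weight_replicate_zero (n : ℕ) :
    weight (List.replicate n 0) = -n := by
  induction n with
  | zero => rfl
  | succ n ih => simp [List.replicate_succ, ih]

theorem weight_drop_of_le (h : Unreduced s b cs) {i : ℕ} (hi : i ≤ s.length)
    (hib : s.length ≤ i + b) : weight (s.drop i) = (i : ℤ) - s.length := by
  obtain ⟨s₀, rfl, -⟩ := h.exists_replicate
  simp only [List.length_append, List.length_replicate] at hi hib ⊢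
  rw [List.drop_append, List.drop_of_length_le (by omega), List.nil_append, List.drop_replicate,
    weight_replicate_zero]
  omega

/-- Such a suffix contains the top pending letter. That letter outweighs its left operands by the
$c$ operands still missing, less one; the $b$ trailing letters subtract $b$, and deeper pending
letters cannot lower the bound. -/
theorem weight_drop_ge {c : ℕ} (h : Unreduced s b (c :: cs)) {i : ℕ}
    (hi : i + b < s.length) : (c : ℤ) - 1 - b ≤ weight (s.drop i) := by
  generalize hcs : c :: cs = cs' at h
  induction h generalizing i c cs with
  | nil => simp at hcs
  | @zero s b cs h hc ih =>
    simp only [List.length_append, List.length_singleton] at hi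
    rw [List.drop_append_of_le_length (by omega), weight_append]
    have := ih (i := i) (by omega) hcs
    simp
    omega
  | @push s b m cs' h hm ih =>
    simp only [List.length_append, List.length_singleton] at hi
    rw [List.drop_append_of_le_length (by omega), weight_append]
    obtain ⟨rfl, rfl⟩ := List.cons.inj hcs
    have : -(b : ℤ) ≤ weight (s.drop i) := by
      rcases Nat.lt_or_ge (i + b) s.length with hib | hib
      · cases cs with
        | nil => have := h.length_eq_of_nil; omega
        | cons c cs =>
          have h₁ := ih hib rfl
          have h₂ := h.lt_head c (by simp)
          omega
      · rw [h.weight_drop_of_le (by omega) hib]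
        omega
    simp
    omega

/-- A suffix of trailing letters $x$ has weight at most $-2$; a longer one has weight at least
$c-1-b\ge 0$. -/
theorem weight_drop_ne (h : Unreduced s b cs) {i : ℕ} (hi : i + 2 ≤ s.length) :
    weight (s.drop i) ≠ -1 := by
  rcases Nat.lt_or_ge (i + b) s.length with hib | hib
  · cases cs with
    | nil => have := h.length_eq_of_nil; omega
    | cons c cs =>
      have h₁ := h.weight_drop_ge hib
      have h₂ := h.lt_head c (by simp)
      omega
  · rw [h.weight_drop_of_le (by omega) hib]
    omega

theorem weight_sub_ne (h : Unreduced s b cs) {e l : ℕ} (hl : 2 ≤ l) (hle : l ≤ e)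
    (he : e ≤ s.length) : weight (s.sub e l) ≠ -1 := by
  obtain ⟨b', cs', h'⟩ := h.take e
  have hlen : (s.take e).length = e := by rw [List.length_take]; omega
  have : s.sub e l = (s.take e).drop (e - l) := by
    rw [sub, List.drop_take]
    congr 1
    omega
  rw [this]
  exact h'.weight_drop_ne (by omega)

end Unreduced

theorem length_corolla (p q : ℕ) : (corolla p q).length = p + q + 1 := by
  simp [corolla]; omega

/-- A word is read without reductions, or up to the end of its leftmost reducible subword. -/
theorem unreduced_or_exists_corolla (u : DiffWord) :
    (∃ b cs, Unreduced u b cs) ∨ ∃ u₁ p q u₂ b cs, u = u₁ ++ corolla p q ++ u₂ ∧ 1 ≤ p + q ∧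
      Unreduced u₁ b cs ∧ Fits b cs p q ∧
      ∃ s m b' cs', u₁ ++ corolla p q = s ++ [m] ∧ Unreduced s b' cs' := by
  induction u using List.reverseRecOn with
  | nil => exact Or.inl ⟨_, _, .nil⟩
  | append_singleton s m ih =>
    rcases ih with ⟨b, cs, h⟩ | ⟨u₁, p, q, u₂, b, cs, rfl, h⟩
    · obtain ⟨s₀, hs, h₀⟩ := h.exists_replicate
      rcases Nat.eq_zero_or_pos m with rfl | hm0
      · by_cases hc : ∀ c ∈ cs.head?, b + 1 < c
        · exact Or.inl ⟨_, _, h.zero hc⟩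
        · right
          cases cs with
          | nil => simp at hc
          | cons c cs =>
            have hbc := h.lt_head c (by simp)
            obtain rfl : c = b + 1 := by simp at hc; omega
            obtain ⟨s₁, b₁, hs₁, h₁, hb₁⟩ := h₀.exists_push
            -- The new $x$ completes the pending letter, which took $b_1$ operands on the left and
            -- now has $b+1$ on the right.
            refine ⟨s₁, b₁, b + 1, [], 0, cs, ?_, by omega, h₁, ⟨by simpa using hb₁, Or.inr rfl⟩,
              s, 0, _, _, ?_, h⟩ <;>
            · rw [hs, hs₁]
              simp [corolla, List.replicate_succ']
      · rcases Nat.lt_or_ge b m with hbm | hbm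
        · exact Or.inl ⟨_, _, h.push hbm⟩
        · right
          have hcs := h.lt_head
          -- The letter $x^{(m)}$ takes the last $m$ of the $b$ available letters $x$; the other
          -- $b-m$ remain in `u₁`.
          have h₁ := h₀.append_replicate (p := b - m) fun c hc => by have := hcs c hc; omega
          rw [zero_add] at h₁
          have hrep : s₀ ++ List.replicate (b - m) 0 ++ corolla m 0 = s ++ [m] := by
            rw [hs]
            simp only [corolla, List.append_assoc, ← List.append_assoc (List.replicate (b - m) 0),
              List.replicate_append_replicate, Nat.sub_add_cancel hbm]
            simp
          exact ⟨_, m, 0, [], _, cs, by rw [hrep, List.append_nil], by omega, h₁,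
            ⟨fun c hc => by have := hcs c hc; omega, Or.inl rfl⟩, s, m, b, cs, hrep, h⟩
    · exact Or.inr ⟨u₁, p, q, u₂ ++ [m], b, cs, by simp, h⟩

end DiffWord

/-! ### The standard bracketing contracts the leftmost corolla -/

open DiffWord

theorem OpMon.leaves_subst (t s : OpMon) {i : ℕ} (hi : i < t.leaves) :
    (t.subst i s).leaves + 1 = t.leaves + s.leaves := by
  induction t generalizing i with
  | x =>
    obtain rfl : i = 0 := by simpa [OpMon.leaves] using hi
    simp [OpMon.subst, OpMon.leaves, add_comm]
  | prec a b iha ihb =>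
    simp only [OpMon.subst, OpMon.leaves] at hi ⊢
    split_ifs with h
    · have := iha h; simp only [OpMon.leaves]; omega
    · have := ihb (i := i - a.leaves) (by omega); simp only [OpMon.leaves]; omega
  | succ a b iha ihb =>
    simp only [OpMon.subst, OpMon.leaves] at hi ⊢
    split_ifs with h
    · have := iha h; simp only [OpMon.leaves]; omega
    · have := ihb (i := i - a.leaves) (by omega); simp only [OpMon.leaves]; omega

theorem OpMon.leaves_rightComb (q : ℕ) : (rightComb q).leaves = q + 1 := by
  induction q with
  | zero => rfl
  | succ q ih => simp [rightComb, leaves, ih]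

theorem OpMon.leaves_precIter (p : ℕ) (t : OpMon) : (precIter p t).leaves = p + t.leaves := by
  induction p with
  | zero => simp [precIter]
  | succ p ih => simp [precIter, leaves, ih]; omega

namespace DiffWord

theorem weight_corolla (p q : ℕ) : weight (corolla p q) = -1 := by
  simp [corolla]
  ring

/-- The suffix has weight $-l$ if it misses the central letter and $p+q-l\ge 0$ otherwise. So the
corolla is the shortest reducible subword with its end. -/
theorem weight_drop_corolla_ne {p q l : ℕ} (hl : 2 ≤ l) (hl' : l ≤ p + q) :
    weight ((corolla p q).drop (p + q + 1 - l)) ≠ -1 := by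
  rcases Nat.lt_or_ge q l with h | h
  · rw [corolla, List.drop_append_of_le_length (by simp; omega), List.drop_replicate]
    simp
    omega
  · rw [corolla, List.drop_append, List.drop_of_length_le (by simp; omega), List.nil_append,
      List.length_replicate]
    obtain ⟨n, hn⟩ : ∃ n, p + q + 1 - l - p = n + 1 := ⟨q - l, by omega⟩
    rw [hn, List.drop_succ_cons, List.drop_replicate, weight_replicate_zero]
    omega

theorem sub_append_append (u v w : DiffWord) {l : ℕ} (hl : l ≤ v.length) :
    (u ++ v ++ w).sub (u.length + v.length) l = v.drop (v.length - l) := by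
  have : u.length + v.length - l = u.length + (v.length - l) := by omega
  rw [sub, this, List.append_assoc, List.drop_length_add_append, List.drop_append_of_le_length
    (by omega), List.take_append_of_le_length (by simp; omega), List.take_of_length_le
    (by simp; omega)]

theorem sub_append_of_le (u v : DiffWord) {e l : ℕ} (hl : l ≤ e) (he : e ≤ u.length) :
    (u ++ v).sub e l = u.sub e l := by
  rw [sub, sub, List.drop_append_of_le_length (by omega), List.take_append_of_le_length
    (by simp; omega)]

end DiffWord

theorem stdBracket_corolla (p q : ℕ) :
    stdBracket (corolla p q) = OpMon.precIter p (OpMon.rightComb q) := by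
  have hk : (corolla p q).length - 1 = p + q := by simp [length_corolla]
  have hp : (corolla p q).idxOf (p + q) = p := by
    rcases Nat.eq_zero_or_pos (p + q) with h | h
    · obtain ⟨rfl, rfl⟩ := Nat.add_eq_zero_iff.1 h
      rfl
    · rw [corolla, List.idxOf_append_of_notMem (by simp [List.mem_replicate]; omega)]
      simp
  rw [stdBracket]
  simp only [hk, hp, Nat.add_sub_cancel_left]
  exact if_pos rfl

/-- All letters before the end of the corolla form an unreduced word, so no reducible subword ends
earlier; `weight_drop_corolla_ne` excludes shorter ones with the same end. -/
theorem stdBracket_of_corolla {u₁ u₂ s : DiffWord} {p q m b cs} (hpq : 1 ≤ p + q)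
    (hs : u₁ ++ corolla p q = s ++ [m]) (hun : Unreduced s b cs)
    (h : u₁.length + u₂.length ≠ 0) :
    stdBracket (u₁ ++ corolla p q ++ u₂) =
      (stdBracket (u₁ ++ 0 :: u₂)).subst u₁.length (stdBracket (corolla p q)) := by
  set u := u₁ ++ corolla p q ++ u₂ with hu
  have hlc := length_corolla p q
  have hlen : u.length = u₁.length + (p + q + 1) + u₂.length := by
    simp only [hu, List.length_append, hlc]
  have hsl := congrArg List.length hs
  simp only [List.length_append, List.length_singleton, hlc] at hsl
  have hsub {l : ℕ} (hl : l ≤ p + q + 1) :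
      u.sub (u₁.length + (p + q + 1)) l = (corolla p q).drop (p + q + 1 - l) := by
    have := sub_append_append u₁ (corolla p q) u₂ (hlc ▸ hl)
    rwa [hlc] at this
  have hred : u.IsReducible (u₁.length + (p + q + 1)) (p + q + 1) :=
    ⟨⟨by omega, by omega, by omega, by omega⟩, by
      rw [hsub le_rfl, Nat.sub_self, List.drop_zero, weight_corolla]⟩
  have hex : ∃ e, e ≤ u.length ∧ ∃ l, l ≤ e ∧ u.IsReducible e l :=
    ⟨_, by omega, _, by omega, hred⟩
  have he : Nat.find hex = u₁.length + (p + q + 1) := by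
    rw [Nat.find_eq_iff]
    refine ⟨⟨by omega, _, by omega, hred⟩, ?_⟩
    rintro e he ⟨-, l, hl, ⟨hl', -, -, -⟩, hw⟩
    rw [hu, hs, List.append_assoc, sub_append_of_le _ _ hl (by omega)] at hw
    exact hun.weight_sub_ne hl' hl (by omega) hw
  have hl : Nat.find (Nat.find_spec hex).2 = p + q + 1 := by
    rw [Nat.find_eq_iff, he]
    refine ⟨⟨by omega, hred⟩, ?_⟩
    rintro l hl ⟨-, ⟨hl', -, -, -⟩, hw⟩
    rw [hsub hl.le] at hw
    exact weight_drop_corolla_ne hl' (by omega) hw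
  have hmem : p + q ∈ u := by simp [hu, corolla]
  rw [stdBracket]
  simp only
  rw [if_neg, dif_pos hex, hl, he, Nat.add_sub_cancel, hsub le_rfl]
  · congr 2
    · rw [hu, List.append_assoc, List.take_left, ← List.append_assoc]
      congr 2
      rw [show u₁.length + (p + q + 1) = (u₁ ++ corolla p q).length by
        rw [List.length_append, hlc], List.drop_left]
    · simp
  -- The first clause cannot apply: its word has only the letters $0$ and `u.length - 1`, while
  -- $p+q$ occurs in `u` and lies strictly between.
  · intro heq
    rw [heq] at hmem
    simp only [List.mem_append, List.mem_replicate, List.mem_cons] at hmem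
    omega

/-! ### The words in the value of a bracketed corolla -/

namespace DiffWord

theorem sum_raise {j : ℕ} {u : DiffWord} (h : j < u.length) :
    (raise j u).sum = u.sum + 1 := by
  induction u generalizing j with
  | nil => simp at h
  | cons n u ih =>
    cases j with
    | zero => simp; omega
    | succ j => simp [ih (by simpa using h)]; omega

theorem sum_take_raise_le (j i : ℕ) (u : DiffWord) :
    ((raise j u).take i).sum ≤ (u.take i).sum + 1 := by
  induction u generalizing i j with
  | nil => simp [raise]
  | cons n u ih =>
    cases i with
    | zero => simp
    | succ i =>
      cases j with
      | zero => simp; omega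
      | succ j => have := ih j i; simp; omega

/-- The words that occur in the `m`-th derivative of the value of a corolla. -/
def corollaWords (p q m : ℕ) : Set DiffWord :=
  {y | y.length = p + q + 1 ∧ y.sum = p + q + m ∧ ∀ t < p, (y.take (t + 1)).sum ≤ t + m}

/-- The nonleading words that occur in the value of a corolla. -/
def corollaRest (p q : ℕ) : Set DiffWord :=
  {y | y ∈ corollaWords p q 0 ∧ y.getD p 0 < p + q}

theorem corolla_mem (p q : ℕ) : corolla p q ∈ corollaWords p q 0 := by
  refine ⟨length_corolla p q, by simp [corolla], fun t ht => ?_⟩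
  rw [corolla, List.take_append_of_le_length (by simp; omega), List.take_replicate]
  simp

theorem getD_corolla (p q : ℕ) : (corolla p q).getD p 0 = p + q := by
  rw [corolla, List.getD_append_right _ _ _ _ (by simp)]
  simp

theorem raise_corolla (p q : ℕ) :
    raise p (corolla p q) = List.replicate p 0 ++ (p + q + 1) :: List.replicate q 0 := by
  have := raise_append_add 0 (List.replicate p 0) ((p + q) :: List.replicate q 0)
  simpa [corolla] using this

theorem raise_mem {p q m j : ℕ} {y : DiffWord} (h : y ∈ corollaWords p q m)
    (hj : j < y.length) : raise j y ∈ corollaWords p q (m + 1) := by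
  refine ⟨by simp [h.1], by rw [sum_raise hj, h.2.1]; rfl, fun t ht => ?_⟩
  have h₁ := h.2.2 t ht
  have h₂ := sum_take_raise_le j (t + 1) y
  omega

theorem raise_append_mem_corollaRest {q j : ℕ} {y : DiffWord} (h : y ∈ corollaWords 0 q 0)
    (hj : j < y.length) (hy : (raise j y).getD 0 0 < q + 1) :
    raise j y ++ [0] ∈ corollaRest 0 (q + 1) := by
  refine ⟨⟨by simp [h.1], by simp [sum_raise hj, h.2.1], by simp⟩, ?_⟩
  rw [List.getD_append _ _ _ _ (by rw [length_raise]; omega)]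
  omega

theorem cons_raise_mem_corollaRest {p q j : ℕ} {y : DiffWord} (h : y ∈ corollaWords p q 0)
    (hj : j < y.length) (hy : (raise j y).getD p 0 < p + q + 1) :
    0 :: raise j y ∈ corollaRest (p + 1) q := by
  refine ⟨⟨by simp [h.1]; omega, by simp [sum_raise hj, h.2.1]; omega, fun t ht => ?_⟩, ?_⟩
  · cases t with
    | zero => simp
    | succ t =>
      have h₁ := h.2.2 t (by omega)
      have h₂ := sum_take_raise_le j (t + 1) y
      rw [List.take_succ_cons, List.sum_cons]
      omega
  · rw [List.getD_cons_succ]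
    omega

theorem getD_raise_lt {p K j : ℕ} {y : DiffWord} (hy : y.getD p 0 < K) :
    (raise j y).getD p 0 < K + 1 := by
  rcases eq_or_ne p j with rfl | hj
  · rcases Nat.lt_or_ge p y.length with hp | hp
    · rw [getD_raise_self hp]; omega
    · rw [List.getD_eq_default _ _ (by simpa using hp)]; omega
  · rw [getD_raise_of_ne hj]; omega

end DiffWord

namespace DiffPoly

open DiffWord

variable {k : Type*} [Field k]

/-- Each $\succ x$ differentiates and appends $x$. The first letter reaches order $q+1$ only by
differentiating the first letter of the leading word. -/
theorem eval_rightComb (q : ℕ) : (OpMon.rightComb q).eval k (X k) -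
    Finsupp.single (corolla 0 q) 1 ∈ Finsupp.supported k k (corollaRest 0 q) := by
  induction q with
  | zero => simp [OpMon.rightComb, OpMon.eval, X, corolla]
  | succ q ih =>
    have h : (OpMon.rightComb (q + 1)).eval k (X k) - Finsupp.single (corolla 0 (q + 1)) 1 =
        mul k (d k ((OpMon.rightComb q).eval k (X k) - Finsupp.single (corolla 0 q) 1)) (X k) +
          ∑ j ∈ (Finset.range (corolla 0 q).length).erase 0,
            Finsupp.single (raise j (corolla 0 q) ++ [0]) (1 : k) := by
      have h₀ : 0 ∈ Finset.range (corolla 0 q).length := by simp [length_corolla]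
      have h₁ : raise 0 (corolla 0 q) ++ [0] = corolla 0 (q + 1) := by
        rw [raise_corolla]
        simp [corolla, List.replicate_succ']
      rw [← h₁, Finset.sum_erase_eq_sub h₀, OpMon.rightComb, OpMon.eval, succ_eq]
      simp [X, OpMon.eval]
    rw [h]
    refine add_mem (mem_of_supported ((mul k).flip (X k) ∘ₗ d k) _ (fun y hy => ?_) ih)
      (sum_mem fun j hj => Finsupp.single_mem_supported _ _ ?_)
    · simp only [X, LinearMap.comp_apply, LinearMap.flip_apply, d_single, map_sum, mul_single]
      refine sum_mem fun j hj => Finsupp.single_mem_supported _ _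
        (raise_append_mem_corollaRest hy.1 (Finset.mem_range.1 hj) ?_)
      exact getD_raise_lt (by simpa using hy.2)
    · rw [Finset.mem_erase, Finset.mem_range] at hj
      refine raise_append_mem_corollaRest (corolla_mem 0 q) hj.2 ?_
      rw [getD_raise_of_ne (Ne.symm hj.1), getD_corolla]
      omega

/-- Each $x\prec$ differentiates and prepends $x$; full order at position $p+1$ arises only from the
letter at position $p$ of the leading word. -/
theorem eval_precIter (p q : ℕ) : (OpMon.precIter p (OpMon.rightComb q)).eval k (X k) -
    Finsupp.single (corolla p q) 1 ∈ Finsupp.supported k k (corollaRest p q) := by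
  induction p with
  | zero => exact eval_rightComb q
  | succ p ih =>
    have h : (OpMon.precIter (p + 1) (OpMon.rightComb q)).eval k (X k) -
        Finsupp.single (corolla (p + 1) q) 1 =
        mul k (X k) (d k ((OpMon.precIter p (OpMon.rightComb q)).eval k (X k) -
          Finsupp.single (corolla p q) 1)) +
          ∑ j ∈ (Finset.range (corolla p q).length).erase p,
            Finsupp.single (0 :: raise j (corolla p q)) (1 : k) := by
      have h₀ : p ∈ Finset.range (corolla p q).length := by simp [length_corolla]
      have h₁ : 0 :: raise p (corolla p q) = corolla (p + 1) q := by
        rw [raise_corolla]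
        simp [corolla, List.replicate_succ]
        omega
      rw [← h₁, Finset.sum_erase_eq_sub h₀, OpMon.precIter, OpMon.eval, prec_eq]
      simp [X, OpMon.eval]
    rw [h]
    refine add_mem (mem_of_supported (mul k (X k) ∘ₗ d k) _ (fun y hy => ?_) ih)
      (sum_mem fun j hj => Finsupp.single_mem_supported _ _ ?_)
    · simp only [X, LinearMap.comp_apply, d_single, map_sum, mul_single]
      exact sum_mem fun j hj => Finsupp.single_mem_supported _ _
        (cons_raise_mem_corollaRest hy.1 (Finset.mem_range.1 hj) (getD_raise_lt hy.2))
    · rw [Finset.mem_erase, Finset.mem_range] at hj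
      refine cons_raise_mem_corollaRest (corolla_mem p q) hj.2 ?_
      rw [getD_raise_of_ne (Ne.symm hj.1), getD_corolla]
      omega

/-! ### Substitution for a letter, and its compatibility with evaluation -/

variable (k) in
/-- The substitution of `g` for the `i`-th letter. -/
noncomputable def insert (i : ℕ) (g : DiffPoly k) : DiffPoly k →ₗ[k] DiffPoly k :=
  Finsupp.linearCombination k fun w : DiffWord =>
    mul k (mul k (Finsupp.single (w.take i) 1) ((d k ^ w.getD i 0) g))
      (Finsupp.single (w.drop (i + 1)) 1)

theorem insert_single (g : DiffPoly k) (u v : DiffWord) (n : ℕ) :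
    insert k u.length g (Finsupp.single (u ++ n :: v) 1) =
      mul k (mul k (Finsupp.single u 1) ((d k ^ n) g)) (Finsupp.single v 1) := by
  simp [insert, List.drop_length_add_append]

theorem eq_of_supported {M : Type*} [AddCommGroup M] [Module k M] {s : Set DiffWord}
    {F G : DiffPoly k →ₗ[k] M} (h : ∀ u ∈ s, F (Finsupp.single u 1) = G (Finsupp.single u 1))
    {f : DiffPoly k} (hf : f ∈ Finsupp.supported k k s) : F f = G f := by
  rw [← sub_eq_zero]
  exact mem_of_supported (F - G) ⊥ (fun u hu => by simp [h u hu]) hf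

theorem exists_eq_append_cons {i : ℕ} {u : DiffWord} (h : i < u.length) :
    ∃ v n w, u = v ++ n :: w ∧ v.length = i :=
  ⟨_, _, _, eq_take_append_cons_drop h, by rw [List.length_take]; omega⟩

theorem insert_mul_left {i n : ℕ} (hi : i < n) (g h : DiffPoly k) {f : DiffPoly k}
    (hf : f ∈ Finsupp.supported k k {u : DiffWord | u.length = n}) :
    insert k i g (mul k f h) = mul k (insert k i g f) h := by
  refine eq_of_supported (F := insert k i g ∘ₗ (mul k).flip h)
    (G := (mul k).flip h ∘ₗ insert k i g) (fun u hu => ?_) hf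
  refine eq_of_supported (F := insert k i g ∘ₗ mul k (Finsupp.single u 1))
    (G := mul k (insert k i g (Finsupp.single u 1))) (s := Set.univ) (fun v _ => ?_) (by simp)
  obtain ⟨u, m, w, rfl, rfl⟩ := exists_eq_append_cons (hi.trans_eq (Eq.symm hu))
  rw [LinearMap.comp_apply, mul_single, List.append_assoc, List.cons_append, insert_single,
    insert_single]
  simp only [mul_assoc', mul_single]

theorem insert_mul_right {i n : ℕ} (g : DiffPoly k) {f h : DiffPoly k}
    (hf : f ∈ Finsupp.supported k k {u : DiffWord | u.length = n})
    (hh : h ∈ Finsupp.supported k k {u : DiffWord | i < u.length}) :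
    insert k (n + i) g (mul k f h) = mul k f (insert k i g h) := by
  refine eq_of_supported (F := insert k (n + i) g ∘ₗ (mul k).flip h)
    (G := (mul k).flip (insert k i g h)) (fun u hu => ?_) hf
  refine eq_of_supported (F := insert k (n + i) g ∘ₗ mul k (Finsupp.single u 1))
    (G := mul k (Finsupp.single u 1) ∘ₗ insert k i g) (fun v hv => ?_) hh
  obtain ⟨v, m, w, rfl, rfl⟩ := exists_eq_append_cons hv
  obtain rfl : u.length = n := hu
  rw [LinearMap.comp_apply, LinearMap.comp_apply, mul_single, ← List.append_assoc,
    ← List.length_append, insert_single, insert_single, ← mul_assoc', ← mul_assoc', mul_single]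

/-- Differentiating the selected letter $x^{(n)}$ turns the substituted $d^n g$ into $d^{n+1}g$;
elsewhere both sides follow the Leibniz rule. -/
theorem insert_d {i : ℕ} (g : DiffPoly k) {f : DiffPoly k}
    (hf : f ∈ Finsupp.supported k k {u : DiffWord | i < u.length}) :
    insert k i g (d k f) = d k (insert k i g f) := by
  refine eq_of_supported (F := insert k i g ∘ₗ d k) (G := d k ∘ₗ insert k i g)
    (fun u hu => ?_) hf
  obtain ⟨u, m, w, rfl, rfl⟩ := exists_eq_append_cons hu
  have h₁ := sum_raise_append (fun w => Finsupp.single w (1 : k)) u (m :: w)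
  have h₂ := sum_raise_append (fun w => Finsupp.single (u ++ w) (1 : k)) [m] w
  simp only [List.length_singleton, Finset.sum_range_one, raise_zero_cons,
    List.singleton_append] at h₂
  rw [LinearMap.comp_apply, LinearMap.comp_apply, d_single, h₁, h₂, insert_single, d_mul, d_mul,
    d_single, d_single]
  simp only [map_add, map_sum, insert_single, LinearMap.add_apply, LinearMap.sum_apply]
  rw [pow_succ', Module.End.mul_apply, add_assoc]
  congr 1
  exact Finset.sum_congr rfl fun j hj => by
    have := insert_single g (raise j u) w m
    rwa [length_raise] at this

theorem eval_mem_length (t : OpMon) :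
    t.eval k (X k) ∈ Finsupp.supported k k {u : DiffWord | u.length = t.leaves} :=
  Finsupp.supported_mono (fun _ hu => hu.1) (eval_mem t)

theorem d_mem_length {n : ℕ} {f : DiffPoly k}
    (hf : f ∈ Finsupp.supported k k {u : DiffWord | u.length = n}) :
    d k f ∈ Finsupp.supported k k {u : DiffWord | u.length = n} :=
  d_mem (fun u hu j _ => by simpa using hu) hf

/-- Products and derivatives keep letters in order, so the $i$-th leaf always contributes the $i$-th
letter of each word. -/
theorem eval_subst (t s : OpMon) {i : ℕ} (hi : i < t.leaves) :
    (t.subst i s).eval k (X k) = insert k i (s.eval k (X k)) (t.eval k (X k)) := by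
  induction t generalizing i with
  | x =>
    obtain rfl : i = 0 := by simpa [OpMon.leaves] using hi
    have h := insert_single (s.eval k (X k)) [] [] 0
    have h₁ (f : DiffPoly k) : mul k (Finsupp.single [] 1) f = f :=
      eq_of_supported (F := mul k (Finsupp.single [] 1)) (G := LinearMap.id) (s := Set.univ)
        (fun u _ => by simp) (by simp)
    have h₂ (f : DiffPoly k) : mul k f (Finsupp.single [] 1) = f :=
      eq_of_supported (F := (mul k).flip (Finsupp.single [] 1)) (G := LinearMap.id)
        (s := Set.univ) (fun u _ => by simp) (by simp)
    rw [h₁, h₂] at h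
    simpa [OpMon.subst, OpMon.eval, X] using h.symm
  | prec a b iha ihb =>
    have hlt {n : ℕ} (hn : n < b.leaves) : b.eval k (X k) ∈
        Finsupp.supported k k {u : DiffWord | n < u.length} :=
      Finsupp.supported_mono (fun _ hu => hn.trans_eq (Eq.symm hu)) (eval_mem_length b)
    simp only [OpMon.subst, OpMon.leaves] at hi ⊢
    split_ifs with h
    · rw [OpMon.eval, OpMon.eval, prec_eq, prec_eq, iha h,
        insert_mul_left h _ _ (eval_mem_length a)]
    · have hib : i - a.leaves < b.leaves := by omega
      have hdb : d k (b.eval k (X k)) ∈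
          Finsupp.supported k k {u : DiffWord | i - a.leaves < u.length} :=
        d_mem (fun u hu j _ => by simpa using hu) (hlt hib)
      have := insert_mul_right (i := i - a.leaves) (s.eval k (X k)) (eval_mem_length a) hdb
      rw [Nat.add_sub_cancel' (by omega)] at this
      rw [OpMon.eval, OpMon.eval, prec_eq, prec_eq, ihb hib, this, insert_d _ (hlt hib)]
  | succ a b iha ihb =>
    simp only [OpMon.subst, OpMon.leaves] at hi ⊢
    split_ifs with h
    · rw [OpMon.eval, OpMon.eval, succ_eq, succ_eq, iha h,
        insert_mul_left h _ _ (d_mem_length (eval_mem_length a)), insert_d _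
          (Finsupp.supported_mono (fun _ hu => h.trans_eq (Eq.symm hu)) (eval_mem_length a))]
    · have hib : i - a.leaves < b.leaves := by omega
      have := insert_mul_right (i := i - a.leaves) (s.eval k (X k))
        (d_mem_length (eval_mem_length a)) (Finsupp.supported_mono
          (fun _ hu => hib.trans_eq (Eq.symm hu)) (eval_mem_length b))
      rw [Nat.add_sub_cancel' (by omega)] at this
      rw [OpMon.eval, OpMon.eval, succ_eq, succ_eq, ihb hib, this]

end DiffPoly

/-! ### Leading words, triangularity and the basis -/

namespace DiffPoly

open DiffWord

variable {k : Type*} [Field k]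

theorem eval_corolla_mem (p q : ℕ) : (stdBracket (corolla p q)).eval k (X k) ∈
    Finsupp.supported k k (corollaWords p q 0) := by
  rw [stdBracket_corolla, ← sub_add_cancel (OpMon.eval k (X k) _)
    (Finsupp.single (corolla p q) 1)]
  exact add_mem (Finsupp.supported_mono (fun _ h => h.1) (eval_precIter p q))
    (Finsupp.single_mem_supported _ _ (corolla_mem p q))

theorem d_pow_mem {p q : ℕ} {f : DiffPoly k}
    (hf : f ∈ Finsupp.supported k k (corollaWords p q 0)) (m : ℕ) :
    (d k ^ m) f ∈ Finsupp.supported k k (corollaWords p q m) := by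
  induction m with
  | zero => simpa using hf
  | succ m ih =>
    rw [pow_succ', Module.End.mul_apply]
    exact d_mem (fun u hu j hj => raise_mem hu hj) ih

/-- The words of the same length as `u` that are smaller than `u`. -/
def smallerWords (u : DiffWord) : Set DiffWord :=
  {w | w.length = u.length ∧ key (0, []) w < key (0, []) u}

theorem mul_single_mul_mem {s t : Set DiffWord} {u v : DiffWord} {f : DiffPoly k}
    (hf : f ∈ Finsupp.supported k k s) (h : ∀ y ∈ s, u ++ y ++ v ∈ t) :
    mul k (mul k (Finsupp.single u 1) f) (Finsupp.single v 1) ∈ Finsupp.supported k k t :=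
  mem_of_supported ((mul k).flip (Finsupp.single v 1) ∘ₗ mul k (Finsupp.single u 1)) _
    (fun y hy => by simpa using Finsupp.single_mem_supported _ _ (h y hy)) hf

/-- The substitution of a corolla for a letter `x`, on smaller words. -/
theorem insert_mem_smallerWords {u₁ u₂ : DiffWord} {p q b cs} (hpq : 1 ≤ p + q)
    (hun : Unreduced u₁ b cs) (hfit : Fits b cs p q) {w : DiffWord}
    (hw : w ∈ smallerWords (u₁ ++ 0 :: u₂)) :
    insert k u₁.length ((stdBracket (corolla p q)).eval k (X k)) (Finsupp.single w 1) ∈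
      Finsupp.supported k k (smallerWords (u₁ ++ corolla p q ++ u₂)) := by
  obtain ⟨hl, hkey⟩ := hw
  obtain ⟨w₁, n, w₂, rfl, hl₁⟩ :=
    exists_eq_append_cons (i := u₁.length) (u := w) (by rw [hl]; simp)
  have hl₂ : w₂.length = u₂.length := by
    simp at hl
    omega
  have hc := d_pow_mem (eval_corolla_mem (k := k) p q) n
  rw [← hl₁, insert_single]
  have hlen {y : DiffWord} (hy : y ∈ corollaWords p q n) :
      (w₁ ++ y ++ w₂).length = (u₁ ++ corolla p q ++ u₂).length := by
    simp only [List.length_append, hy.1, length_corolla, hl₁, hl₂]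
  -- Either `w` is already smaller before the substituted letter, and stays so, or the two prefixes
  -- coincide.
  rcases key_append_lt_cases hl₁ hkey with h | ⟨rfl, h⟩
  · refine mul_single_mul_mem hc fun y hy => ⟨hlen hy, ?_⟩
    rw [List.append_assoc, List.append_assoc]
    exact key_append_lt_key_append hl₁ h _ _
  · rw [hun.run_eq, key, key, List.cons_lt_cons_iff] at h
    -- Since `rank b 0 = b`, a letter ranking no higher than $x$ has order at most $b$. This gives
    -- the prefix bound for the words of the $n$-th derivative of the corolla.
    have hnb : n ≤ b ∧ (0 < n ∨ n = 0 ∧ key (step (b, cs) 0) w₂ < key (step (b, cs) 0) u₂) := by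
      rcases h with h | ⟨h, h'⟩
      · simp only [rank] at h
        split_ifs at h <;> omega
      · obtain rfl := rank_injective _ h
        exact ⟨Nat.zero_le _, Or.inr ⟨rfl, h'⟩⟩
    have hmem {y : DiffWord} (hy : y ∈ corollaWords p q n) (hy' : 0 < n ∨ y.getD p 0 < p + q) :
        w₁ ++ y ++ w₂ ∈ smallerWords (w₁ ++ corolla p q ++ u₂) := by
      refine ⟨hlen hy, ?_⟩
      rw [List.append_assoc, List.append_assoc, key_append_lt_iff, hun.run_eq]
      refine key_lt_key_corolla (m := n) hfit.1 (by have := hy.1; omega) hy.2.1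
        (fun t ht => by have := hy.2.2 t ht; omega) ?_ _ _
      rcases Nat.eq_zero_or_pos q with rfl | hq
      · exact Or.inl ⟨rfl, by omega, hy'⟩
      · have := hfit.2
        exact Or.inr ⟨by omega, by omega⟩
    rcases hnb.2 with hn | ⟨rfl, hlt⟩
    · exact mul_single_mul_mem hc fun y hy => hmem hy (Or.inl hn)
    · have hrest := eval_precIter (k := k) p q
      rw [← stdBracket_corolla] at hrest
      rw [pow_zero, Module.End.one_apply, ← sub_add_cancel (OpMon.eval k (X k) _)
        (Finsupp.single (corolla p q) 1), map_add, map_add, LinearMap.add_apply]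
      refine add_mem (mul_single_mul_mem hrest fun y hy => hmem hy.1 (Or.inr hy.2)) ?_
      rw [mul_single, mul_single]
      refine Finsupp.single_mem_supported _ _ ⟨hlen (corolla_mem p q), ?_⟩
      -- Reading the corolla leaves the same state as reading $x$, so the comparison of the
      -- remaining letters is unchanged.
      rw [key_append_lt_iff, run_append, hun.run_eq, run_corolla hfit hpq]
      exact hlt

theorem eval_stdBracket_corolla (p q : ℕ) :
    (stdBracket (corolla p q)).leaves = (corolla p q).length ∧
      (stdBracket (corolla p q)).eval k (X k) - Finsupp.single (corolla p q) 1 ∈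
        Finsupp.supported k k (smallerWords (corolla p q)) := by
  rw [stdBracket_corolla, OpMon.leaves_precIter, OpMon.leaves_rightComb, length_corolla]
  refine ⟨by omega, Finsupp.supported_mono (?_ : corollaRest p q ⊆ smallerWords (corolla p q))
    (eval_precIter p q)⟩
  intro y hy
  constructor
  · rw [hy.1.1, length_corolla]
  · have h := key_lt_key_corolla (b := 0) (p := p) (q := q) (K := p + q) (m := 0) (cs := []) (y := y) (by simp)
      (by have := hy.1.1; omega) hy.1.2.1 (fun t ht => by have := hy.1.2.2 t ht; omega)
      (by have := hy.2; omega) [] []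
    simpa [corolla] using h

/-- The leading word of the value of the standard bracketing of `u` is `u`. -/
theorem eval_stdBracket (u : DiffWord) (hu : weight u = -1) :
    (stdBracket u).leaves = u.length ∧ (stdBracket u).eval k (X k) - Finsupp.single u 1 ∈
      Finsupp.supported k k (smallerWords u) := by
  induction hn : u.length using Nat.strong_induction_on generalizing u with
  | _ n ih =>
  rw [← hn]
  rcases unreduced_or_exists_corolla u with ⟨b, cs, h⟩ |
    ⟨u₁, p, q, u₂, b, cs, rfl, hpq, hun, hfit, s, m, b', cs', hs, hun'⟩
  -- An unreduced word of weight $-1$ has length at most $1$, hence is $x$.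
  · have hl : ¬ 0 + 2 ≤ u.length := fun hl => h.weight_drop_ne hl (by rwa [List.drop_zero])
    obtain rfl : u = corolla 0 0 := by
      match u, hl, hu with
      | [], _, hu => simp at hu
      | [m], _, hu =>
        simp at hu
        simp [corolla]
        omega
      | _ :: _ :: _, hl, _ => simp at hl
    exact eval_stdBracket_corolla 0 0
  · by_cases h0 : u₁.length + u₂.length = 0
    · obtain ⟨h₁, h₂⟩ := Nat.add_eq_zero_iff.1 h0
      rw [List.length_eq_zero_iff] at h₁ h₂
      subst h₁ h₂
      rw [List.nil_append, List.append_nil]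
      exact eval_stdBracket_corolla p q
    · have hlc := length_corolla p q
      obtain ⟨hleaves, hlead⟩ := ih (u₁ ++ 0 :: u₂).length
        (by rw [← hn]; simp only [List.length_append, List.length_cons, hlc]; omega) _
        (by simp [weight_corolla] at hu ⊢; omega) rfl
      obtain ⟨hleaves', -⟩ := eval_stdBracket_corolla (k := k) p q
      have hi : u₁.length < (stdBracket (u₁ ++ 0 :: u₂)).leaves := by rw [hleaves]; simp
      rw [stdBracket_of_corolla hpq hs hun' h0]
      constructor
      · have := OpMon.leaves_subst _ (stdBracket (corolla p q)) hi
        rw [hleaves, hleaves', hlc] at this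
        simp only [List.length_append, List.length_cons, hlc] at this ⊢
        omega
      · rw [eval_subst _ _ hi, ← sub_add_cancel (OpMon.eval k (X k) (stdBracket (u₁ ++ 0 :: u₂)))
          (Finsupp.single (u₁ ++ 0 :: u₂) 1), map_add, add_sub_assoc]
        -- The nonleading words of the shortened word stay small under substitution; its leading
        -- word contributes the corolla in place, plus the corolla's own smaller terms.
        refine add_mem (mem_of_supported _ _
          (fun w hw => insert_mem_smallerWords hpq hun hfit hw) hlead) ?_
        have hrest := eval_precIter (k := k) p q
        rw [← stdBracket_corolla] at hrest
        have heq : Finsupp.single (u₁ ++ corolla p q ++ u₂) (1 : k) = mul k (mul k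
            (Finsupp.single u₁ 1) (Finsupp.single (corolla p q) 1)) (Finsupp.single u₂ 1) := by
          simp
        rw [insert_single, pow_zero, Module.End.one_apply, heq, ← LinearMap.sub_apply,
          ← map_sub (mul k), ← map_sub (mul k (Finsupp.single u₁ 1))]
        refine mul_single_mul_mem hrest fun y hy => ⟨?_, ?_⟩
        · simp only [List.length_append, hy.1.1, hlc]
        · rw [List.append_assoc, List.append_assoc, key_append_lt_iff, hun.run_eq]
          refine key_lt_key_corolla (m := 0) hfit.1 (by have := hy.1.1; omega) hy.1.2.1
            (fun t ht => by have := hy.1.2.2 t ht; omega) ?_ _ _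
          have h₁ := hfit.2
          have h₂ := hy.2
          omega

theorem stdBracket_eval_apply {u w : DiffWord} (hu : weight u = -1)
    (h : (stdBracket u).eval k (X k) w ≠ 0) : w = u ∨ key (0, []) w < key (0, []) u := by
  by_contra! hw
  have hmem := (eval_stdBracket (k := k) u hu).2
  rw [Finsupp.mem_supported'] at hmem
  have := hmem w fun hw' => not_lt.2 hw.2 hw'.2
  rw [Finsupp.sub_apply, Finsupp.single_eq_of_ne hw.1, sub_zero] at this
  exact h this

theorem stdBracket_eval_self {u : DiffWord} (hu : weight u = -1) :
    (stdBracket u).eval k (X k) u = 1 := by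
  have hmem := (eval_stdBracket (k := k) u hu).2
  rw [Finsupp.mem_supported'] at hmem
  have := hmem u fun hu' => lt_irrefl _ hu'.2
  rwa [Finsupp.sub_apply, Finsupp.single_eq_same, sub_eq_zero] at this

/-- In a vanishing combination, the word $u$ of largest key in the support occurs in no other $[v]$
of the support, so its coefficient is zero. -/
theorem linearIndependent_stdBracket : LinearIndependent k
    fun u : weightNegOne => (stdBracket (u : DiffWord)).eval k (X k) := by
  rw [linearIndependent_iff]
  intro l hl
  by_contra hne
  obtain ⟨u, hu, hmax⟩ := l.support.exists_max_image (fun u => key (0, []) (u : DiffWord))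
    (Finsupp.support_nonempty_iff.2 hne)
  have h := DFunLike.congr_fun hl (u : DiffWord)
  rw [Finsupp.linearCombination_apply, Finsupp.sum, Finsupp.finsetSum_apply,
    Finset.sum_eq_single_of_mem u hu] at h
  · rw [Finsupp.smul_apply, stdBracket_eval_self u.2, smul_eq_mul, mul_one] at h
    exact Finsupp.mem_support_iff.1 hu h
  · intro v hv hvu
    rw [Finsupp.smul_apply]
    by_contra h0
    rcases stdBracket_eval_apply v.2 (right_ne_zero_of_smul h0) with h' | h'
    · exact hvu (Subtype.ext h'.symm)
    · exact not_lt.2 (hmax v hv) h'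

theorem finite_words (n : ℕ) : {u : DiffWord | u.length = n ∧ weight u = -1}.Finite := by
  refine (List.finite_length_eq (Fin n) n).image (List.map Fin.val) |>.subset ?_
  rintro u ⟨hl, hw⟩
  have hsum (v : DiffWord) : weight v = (v.sum : ℤ) - v.length := by
    induction v with
    | nil => rfl
    | cons m v ih => simp [ih]; ring
  have hlt : ∀ m ∈ u, m < n := fun m hm => by
    have h₁ := List.single_le_sum (fun _ _ => Nat.zero_le _) m hm
    have h₂ := hsum u
    omega
  refine ⟨u.pmap Fin.mk hlt, by simpa using hl, ?_⟩
  simp [List.map_pmap]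

/-- There are finitely many words of weight $-1$ of a given length, so a counterexample of that
length would have one with minimal key $w$; but $[w]-w$ involves only smaller words of the same
length and weight. -/
theorem supported_le_span_stdBracket : Finsupp.supported k k weightNegOne ≤
    Submodule.span k
      (Set.range fun u : weightNegOne => (stdBracket (u : DiffWord)).eval k (X k)) := by
  rw [Finsupp.supported_eq_span_single, Submodule.span_le]
  rintro _ ⟨u, hu, rfl⟩
  by_contra hbad
  set S := {w : DiffWord | (w.length = u.length ∧ weight w = -1) ∧
    Finsupp.single w (1 : k) ∉ Submodule.span k
      (Set.range fun u : weightNegOne => (stdBracket (u : DiffWord)).eval k (X k))}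
  have hfin : S.Finite := (finite_words u.length).subset fun w hw => hw.1
  obtain ⟨w, hw, hmin⟩ := hfin.exists_minimalFor (key (0, [])) S ⟨u, ⟨rfl, hu⟩, hbad⟩
  refine hw.2 ?_
  obtain ⟨hleaves, hmem⟩ := eval_stdBracket (k := k) w hw.1.2
  rw [← sub_sub_cancel (OpMon.eval k (X k) (stdBracket w)) (Finsupp.single w 1)]
  refine sub_mem (Submodule.subset_span ⟨⟨w, hw.1.2⟩, rfl⟩) ?_
  have hmem' : OpMon.eval k (X k) (stdBracket w) - Finsupp.single w 1 ∈
      Finsupp.supported k k weightNegOne :=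
    sub_mem (eval_mem_weightNegOne _) (Finsupp.single_mem_supported _ _ hw.1.2)
  have hinter := Finsupp.supported_inter (M := k) (R := k) (smallerWords w) weightNegOne ▸
    Submodule.mem_inf.2 ⟨hmem, hmem'⟩
  refine mem_of_supported LinearMap.id _ (fun v hv => ?_) hinter
  by_contra hv'
  exact not_le.2 hv.1.2 (hmin ⟨⟨hv.1.1.trans hw.1.1, hv.2⟩, hv'⟩ hv.1.2.le)

end DiffPoly

theorem mainTheorem1 (k : Type*) [Field k] :
    ∃ b : Module.Basis weightNegOne k (FreeNCNovikov k),
      ∀ u : weightNegOne, b u = (stdBracket (u : DiffWord)).eval k (FreeNCNovikov.gen k) := by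
  have hli : LinearIndependent k fun u : weightNegOne =>
      (stdBracket (u : DiffWord)).eval k (FreeNCNovikov.gen k) := by
    -- Independence may be tested on the images in the free differential algebra.
    refine .of_comp (FreeNCNovikov.lift (DiffPoly.X k)) ?_
    have h : FreeNCNovikov.lift (DiffPoly.X k) ∘ (fun u : weightNegOne =>
        (stdBracket (u : DiffWord)).eval k (FreeNCNovikov.gen k)) =
        fun u : weightNegOne => (stdBracket (u : DiffWord)).eval k (DiffPoly.X k) :=
      funext fun u => FreeNCNovikov.lift_eval _ _
    rw [h]
    exact DiffPoly.linearIndependent_stdBracket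
  refine ⟨Module.Basis.mk hli ?_, fun u => Module.Basis.mk_apply _ _ u⟩
  rw [← FreeNCNovikov.span_range_eval_gen, Submodule.span_le]
  rintro _ ⟨t, rfl⟩
  -- The value of `t` as a differential polynomial is a combination of values of brackets;
  -- evaluating words at the free generator turns this into the same relation in the free Novikov
  -- algebra.
  have h := Submodule.mem_map_of_mem (f := DiffPoly.toNCNovikov k (FreeNCNovikov.gen k))
    (DiffPoly.supported_le_span_stdBracket (DiffPoly.eval_mem_weightNegOne (k := k) t))
  have h' : DiffPoly.toNCNovikov k (FreeNCNovikov.gen k) ∘ (fun u : weightNegOne =>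
      (stdBracket (u : DiffWord)).eval k (DiffPoly.X k)) =
      fun u : weightNegOne => (stdBracket (u : DiffWord)).eval k (FreeNCNovikov.gen k) :=
    funext fun u => DiffPoly.toNCNovikov_eval _ _
  rwa [DiffPoly.toNCNovikov_eval, Submodule.map_span, ← Set.range_comp, h'] at h
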